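/- Let $0<T<\infty$ and let $(\Omega,\mathcal F,(\mathcal F_t)_{0\le t\le T},\mathrm P)$ be a filtered probability space with a right-continuous filtration such that $\mathcal F_0$ contains only sets of probability $0$ or $1$ and contains all null sets of $\mathcal F$. Assume that for every $t\in(0,T]$ the space $(\Omega,\mathcal F_t,\mathrm P|_{\mathcal F_t})$ is atomless and $\mathcal F_t$ is countably generated up to $\mathrm P$-null sets (i.e. there is a countably generated $\sigma$-algebra $\mathcal G\subseteq\mathcal F_t$ such that every set of $\mathcal F_t$ differs from a set of $\mathcal G$ by a $\mathrm P$-null set). Let $\Phi:[0,\infty)\to[0,\infty]$ be lower semicontinuous and convex, with $1$ in the interior of $\{\Phi<\infty\}$, $\inf_{x\ge0}\Phi(x)=0$ and $\lim_{x\to\infty}\Phi(x)/x=\infty$, and let $\Phi^*(y)=\sup_{x\ge 0}(xy-\Phi(x))$, $y\in\mathbb R$, which is finite. Let $(Y_t)_{t\in[0,T]}$ be a nonnegative right-continuous adapted process such that $S:=\sup_{t\in[0,T]}Y_t$ is a.s. finite and belongs to the Orlicz heart $H^{\Phi^*}$, i.e. $\mathbb E[\Phi^*(cS)]<\infty$ for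 all $c>0$. Let $\mathcal T$ be the set of stopping times with values in $[0,T]$, and let $\mathcal T^r$ be the set of randomized stopping times with values in $[0,T]$, i.e. of all maps $\tau^r:\Omega\times[0,1]\to[0,T]$ that are nondecreasing and left-continuous in the second argument and for which $\tau^r(\cdot,u)$ is a stopping time for every $u\in[0,1]$. Write $Y^r_{\tau^r}(\omega,u)=Y_{\tau^r(\omega,u)}(\omega)$; expectations involving $Y^r_{\tau^r}$ are taken under $\mathrm P\otimes\mathrm P^U$, where $\mathrm P^U$ is the uniform distribution on $[0,1]$. Let $\mathcal Q_{\Phi,0}$ be the set of probability measures $\mathrm Q\ll\mathrm P$ on $\mathcal F$ with $\mathrm Q=\mathrm P$ on $\mathcal F_0$ for which $\Phi(d\mathrm Q/d\mathrm P)$ is $\mathrm P$-integrable. Then the random variables $\Phi^*(x+Y^r_{\tau^r})-x$ and $\Phi^*(x+Y_\tau)-x$ (for $x\in\mathbb R$, $\tau^r\in\mathcal T^r$, $\tau\in\mathcal T$) are integrable, $Y_\tau$ is $\mathrm Q$-integrable for all $\tau\in\mathcal T$ and $\mathrm Q\in\mathcal Q_{\Phi,0}$, and $$\sup_{\tau^r\in\mathcal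 T^r}\inf_{x\in\mathbb R}\mathbb E[\Phi^*(x+Y^r_{\tau^r})-x]=\sup_{\tau\in\mathcal T}\inf_{x\in\mathbb R}\mathbb E[\Phi^*(x+Y_\tau)-x]=\sup_{\tau\in\mathcal T}\sup_{\mathrm Q\in\mathcal Q_{\Phi,0}}\Bigl(\mathbb E_{\mathrm Q}[Y_\tau]-\mathbb E\Bigl[\Phi\Bigl(\frac{d\mathrm Q}{d\mathrm P}\Bigr)\Bigr]\Bigr).$$ -/

import Mathlib

open MeasureTheory Filter Topology
open scoped NNReal ENNReal

namespace RobustStopping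

/-! ### The divergence function and its conjugate -/

/-- The standing conditions on a divergence function `Φ : [0,∞) → [0,∞]`: it is lower
semicontinuous and convex, `1` is interior to its effective domain, its infimum is `0`, and
`Φ x / x → ∞` as `x → ∞`. -/
structure IsDivergenceFunction (Φ : ℝ≥0 → ℝ≥0∞) : Prop where
  lowerSemicontinuous : LowerSemicontinuous Φ
  convexOn : ConvexOn ℝ≥0 Set.univ Φ
  one_mem_interior_dom : (1 : ℝ≥0) ∈ interior {x | Φ x < ∞}
  iInf_eq_zero : ⨅ x, Φ x = 0
  tendsto_div : Tendsto (fun x : ℝ≥0 => Φ x / (x : ℝ≥0∞)) atTop (𝓝 ∞)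

/-- The Fenchel-Legendre transform `Φ* y = sup_{x ≥ 0} (x y - Φ x)`, as an extended real. -/
noncomputable def conjugate (Φ : ℝ≥0 → ℝ≥0∞) (y : ℝ) : EReal :=
  ⨆ x : ℝ≥0, (((x : ℝ) * y : ℝ) : EReal) - ((Φ x : ℝ≥0∞) : EReal)

/-- The Fenchel-Legendre transform as a real-valued function. It agrees with `conjugate` for the
divergence functions considered here, see `coe_realConjugate`. -/
noncomputable def realConjugate (Φ : ℝ≥0 → ℝ≥0∞) (y : ℝ) : ℝ :=
  (conjugate Φ y).toReal

theorem conjugate_ne_bot {Φ : ℝ≥0 → ℝ≥0∞} (hΦ : IsDivergenceFunction Φ) (y : ℝ) :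
    conjugate Φ y ≠ ⊥ := by
  have h1 : (1 : ℝ≥0) ∈ {x | Φ x < ∞} := interior_subset hΦ.one_mem_interior_dom
  replace h1 : Φ 1 < ∞ := h1
  have h : ((((1 : ℝ≥0) : ℝ) * y : ℝ) : EReal) - ((Φ 1 : ℝ≥0∞) : EReal) ≤ conjugate Φ y :=
    le_iSup (fun x : ℝ≥0 => (((x : ℝ) * y : ℝ) : EReal) - ((Φ x : ℝ≥0∞) : EReal)) 1
  intro hb
  rw [hb, le_bot_iff] at h
  lift Φ 1 to ℝ≥0 using h1.ne with a ha
  exact EReal.coe_ne_bot ((((1 : ℝ≥0) : ℝ) * y) - (a : ℝ)) (by exact_mod_cast h)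

theorem conjugate_ne_top {Φ : ℝ≥0 → ℝ≥0∞} (hΦ : IsDivergenceFunction Φ) (y : ℝ) :
    conjugate Φ y ≠ ⊤ := by
  have h := hΦ.tendsto_div.eventually (lt_mem_nhds (show ENNReal.ofReal |y| < ∞ by simp))
  obtain ⟨N, hN⟩ := eventually_atTop.1 h
  have hle : conjugate Φ y ≤ (((N : ℝ) * |y| : ℝ) : EReal) := by
    refine iSup_le fun x => ?_
    have hxy : (x : ℝ) * y ≤ x * |y| := mul_le_mul_of_nonneg_left (le_abs_self y) x.2
    induction hx : Φ x using ENNReal.recTopCoe with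
    | top => simp
    | coe a =>
      have key : (x : ℝ) * y - a ≤ N * |y| := by
        rcases le_total x N with hxN | hxN
        · have : (x : ℝ) * |y| ≤ N * |y| :=
            mul_le_mul_of_nonneg_right (by exact_mod_cast hxN) (abs_nonneg y)
          have ha : (0 : ℝ) ≤ a := a.2
          linarith
        · have h2 := hN x hxN
          rw [hx] at h2
          have h3 : ENNReal.ofReal |y| * x ≤ a :=
            (ENNReal.le_div_iff_mul_le (Or.inr (by
              intro h0
              rw [h0] at h2
              simp at h2)) (Or.inl (by simp))).1 h2.le
          have h4 : |y| * x ≤ a := by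
            have := ENNReal.toReal_mono (by simp) h3
            simpa using this
          have : 0 ≤ (N : ℝ) * |y| := mul_nonneg N.2 (abs_nonneg y)
          linarith
      have : (((x : ℝ) * y - (a : ℝ) : ℝ) : EReal) ≤ (((N : ℝ) * |y| : ℝ) : EReal) := by
        exact_mod_cast key
      rw [EReal.coe_sub] at this
      exact this
  intro ht
  rw [ht, top_le_iff] at hle
  exact EReal.coe_ne_top _ hle

theorem coe_realConjugate {Φ : ℝ≥0 → ℝ≥0∞} (hΦ : IsDivergenceFunction Φ) (y : ℝ) :
    ((realConjugate Φ y : ℝ) : EReal) = conjugate Φ y :=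
  EReal.coe_toReal (conjugate_ne_top hΦ y) (conjugate_ne_bot hΦ y)

/-! ### Orlicz heart -/

/-- `X` belongs to the Orlicz heart of `Ψ` (only the values of `Ψ` on `[0,∞)`, which are to be
nonnegative, matter): `X` is a random variable with `E[Ψ(c |X|)] < ∞` for every `c > 0`. -/
def MemOrliczHeart {Ω : Type*} [MeasurableSpace Ω] (Ψ : ℝ → EReal) (X : Ω → ℝ)
    (P : Measure Ω) : Prop :=
  AEMeasurable X P ∧ ∀ c : ℝ, 0 < c → ∫⁻ ω, (Ψ (c * |X ω|)).toENNReal ∂P < ∞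

/-! ### Filtered probability spaces -/

/-- The restriction of `P` to the sub-σ-algebra `m` has no atoms: every `m`-measurable set of
positive probability has an `m`-measurable subset of strictly smaller positive probability. -/
def AtomlessOn {Ω : Type*} [MeasurableSpace Ω] (P : Measure Ω) (m : MeasurableSpace Ω) : Prop :=
  ∀ A, MeasurableSet[m] A → 0 < P A → ∃ B ⊆ A, MeasurableSet[m] B ∧ 0 < P B ∧ P B < P A

/-- The σ-algebra `m` is countably generated up to `P`-null sets: it has a countably generated
sub-σ-algebra `m'` such that each set of `m` differs from a set of `m'` by a null set only. -/
def CountablyGeneratedModNull {Ω : Type*} [MeasurableSpace Ω] (P : Measure Ω)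
    (m : MeasurableSpace Ω) : Prop :=
  ∃ m' : MeasurableSpace Ω, m' ≤ m ∧ @MeasurableSpace.CountablyGenerated Ω m' ∧
    ∀ A, MeasurableSet[m] A → ∃ B, MeasurableSet[m'] B ∧ A =ᵐ[P] B

/-- The stopping times with values in `[0,T]`. -/
def stoppingTimes {Ω : Type*} {m0 : MeasurableSpace Ω} {T : ℝ}
    (F : Filtration (Set.Icc (0 : ℝ) T) m0) : Set (Ω → Set.Icc (0 : ℝ) T) :=
  {τ | IsStoppingTime F (fun ω => (τ ω : WithTop (Set.Icc (0 : ℝ) T)))}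

/-- The randomized stopping times with values in `[0,T]`: maps `τ` of `ω` and `u ∈ [0,1]` that are
nondecreasing and left-continuous in `u` and for which each `τ(·,u)` is a stopping time. -/
def randomizedStoppingTimes {Ω : Type*} {m0 : MeasurableSpace Ω} {T : ℝ}
    (F : Filtration (Set.Icc (0 : ℝ) T) m0) : Set (Ω → unitInterval → Set.Icc (0 : ℝ) T) :=
  {τ | (∀ ω, Monotone (τ ω)) ∧ (∀ ω u, ContinuousWithinAt (τ ω) (Set.Iio u) u) ∧
    ∀ u, (fun ω => τ ω u) ∈ stoppingTimes F}

/-- The probability measures `Q ≪ P` for which `Φ(dQ/dP)` is `P`-integrable and which agree with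
`P` on the σ-algebra `F t`. -/
def divergenceMeasures {Ω : Type*} {m0 : MeasurableSpace Ω} {T : ℝ} (Φ : ℝ≥0 → ℝ≥0∞)
    (P : Measure Ω) (F : Filtration (Set.Icc (0 : ℝ) T) m0) (t : Set.Icc (0 : ℝ) T) :
    Set (Measure Ω) :=
  {Q | IsProbabilityMeasure Q ∧ Q ≪ P ∧ ∫⁻ ω, Φ (Q.rnDeriv P ω).toNNReal ∂P < ∞ ∧
    ∀ A, MeasurableSet[F t] A → Q A = P A}

end RobustStopping

namespace RobustStopping

variable {Φ : ℝ≥0 → ℝ≥0∞}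

/-! ### The conjugate of a divergence function -/

/-! Randomization gains nothing because the attainable expectations are almost convex. Since `Φ* x -
x` is coercive, only `x` in some `[-R, R]` matter, and `G y = (x ↦ Φ* (x + y) - x)` becomes an
element of the Banach space `C([-R, R])`. Two stopping times bounded below by `c > 0` can be pasted
along a set `A ∈ F c`. As `F c` is atomless and countably generated modulo null sets, `A` can be
chosen so that the expectation of `G` at the pasted time is as close as desired to a given convex
combination. So the closure of these expectations is convex (`convex_closure_positiveValues`). By
right-continuity of `Y` it also contains the expectations for all stopping times
(`integral_stopped_mem_closure`), hence their averages over `u`, which are the randomized ones.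
Closeness in sup norm is uniform in `x`, so it passes to the infima (`iInf_randomized_le`).

The robust representation holds for each `Z = Y τ` separately. Integrating the Fenchel-Young
inequality gives one direction. For the other, take a minimizer `x₀` of `E[Φ* (x + Z)] - x`. Its
first-order condition says that the smallest and largest subgradients of `Φ*` at `x₀ + Z` have means
on either side of `1`. A mixture with mean `1` is a density for which Fenchel-Young is an equality
(`exists_density`, `exists_measure_integral_sub_eq`). -/

theorem IsDivergenceFunction.mul_le_realConjugate_add (hΦ : IsDivergenceFunction Φ) {q : ℝ≥0}
    (hq : Φ q ≠ ∞) (y : ℝ) : q * y ≤ realConjugate Φ y + (Φ q).toReal := by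
  have h : (((q : ℝ) * y : ℝ) : EReal) - ((Φ q : ℝ≥0∞) : EReal) ≤ realConjugate Φ y := by
    rw [coe_realConjugate hΦ]
    exact le_iSup (fun x : ℝ≥0 => (((x : ℝ) * y : ℝ) : EReal) - ((Φ x : ℝ≥0∞) : EReal)) q
  lift Φ q to ℝ≥0 using hq with a ha
  have h' : (((q : ℝ) * y - (a : ℝ) : ℝ) : EReal) ≤ (realConjugate Φ y : EReal) := by
    rw [EReal.coe_sub]; exact h
  have := EReal.coe_le_coe_iff.1 h'
  simp only [ENNReal.coe_toReal]
  linarith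

theorem IsDivergenceFunction.realConjugate_le (hΦ : IsDivergenceFunction Φ) {y c : ℝ}
    (h : ∀ q, Φ q ≠ ∞ → q * y - (Φ q).toReal ≤ c) : realConjugate Φ y ≤ c := by
  rw [← EReal.coe_le_coe_iff, coe_realConjugate hΦ]
  refine iSup_le fun q => ?_
  by_cases hq : Φ q = ∞
  · simp [hq]
  · have := h q hq
    lift Φ q to ℝ≥0 using hq with a ha
    rw [← EReal.coe_le_coe_iff, EReal.coe_sub] at this
    exact this

/-- The points at which the supremum defining the conjugate is attained. -/
def argmaxSet (Φ : ℝ≥0 → ℝ≥0∞) (y : ℝ) : Set ℝ≥0 :=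
  {q | realConjugate Φ y ≤ q * y ∧ Φ q ≤ ENNReal.ofReal (q * y - realConjugate Φ y)}

/-- The definition avoids `toReal` so that its graph is visibly closed; this real-valued form serves
the estimates. -/
theorem mem_argmaxSet_iff {y : ℝ} {q : ℝ≥0} :
    q ∈ argmaxSet Φ y ↔ Φ q ≠ ∞ ∧ realConjugate Φ y + (Φ q).toReal ≤ q * y := by
  constructor
  · rintro ⟨h1, h2⟩
    refine ⟨(h2.trans_lt ENNReal.ofReal_lt_top).ne, ?_⟩
    have := ENNReal.toReal_mono ENNReal.ofReal_ne_top h2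
    rw [ENNReal.toReal_ofReal (by linarith)] at this
    linarith
  · rintro ⟨h1, h2⟩
    have : 0 ≤ (Φ q).toReal := ENNReal.toReal_nonneg
    refine ⟨by linarith, ?_⟩
    rw [← ENNReal.ofReal_toReal h1]
    exact ENNReal.ofReal_le_ofReal (by linarith)

theorem IsDivergenceFunction.eq_of_mem_argmaxSet (hΦ : IsDivergenceFunction Φ) {y : ℝ} {q : ℝ≥0}
    (hq : q ∈ argmaxSet Φ y) : (Φ q).toReal = q * y - realConjugate Φ y := by
  rw [mem_argmaxSet_iff] at hq
  have := hΦ.mul_le_realConjugate_add hq.1 y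
  linarith [hq.2]

/-- Maximizers are subgradients: Fenchel-Young at `z` against equality at `y`. -/
theorem IsDivergenceFunction.add_mul_sub_le (hΦ : IsDivergenceFunction Φ) {y : ℝ} {q : ℝ≥0}
    (hq : q ∈ argmaxSet Φ y) (z : ℝ) :
    realConjugate Φ y + q * (z - y) ≤ realConjugate Φ z := by
  rw [mem_argmaxSet_iff] at hq
  have := hΦ.mul_le_realConjugate_add hq.1 z
  linarith [hq.2]

/-- Superlinear growth confines good candidates to a compact interval, where lower semicontinuity
gives a maximizer. -/
theorem IsDivergenceFunction.argmaxSet_nonempty (hΦ : IsDivergenceFunction Φ) (y : ℝ) :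
    (argmaxSet Φ y).Nonempty := by
  -- With this slope and `q ≥ 1`, the objective is at most `-|Φ* y| - 1`, hence misses the supremum
  -- by at least `1`.
  have h := hΦ.tendsto_div.eventually
    (lt_mem_nhds (show ENNReal.ofReal (|y| + |realConjugate Φ y| + 1) < ∞ by simp))
  obtain ⟨N', hN'⟩ := eventually_atTop.1 h
  set N := max N' 1
  have hN : ∀ q, N ≤ q → Φ q ≠ ∞ → q * y - (Φ q).toReal ≤ realConjugate Φ y - 1 := by
    intro q hq hfin
    have h2 := hN' q ((le_max_left _ _).trans hq)
    have h1 : (1 : ℝ) ≤ q := by exact_mod_cast (le_max_right N' 1).trans hq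
    have h3 : ENNReal.ofReal (|y| + |realConjugate Φ y| + 1) * q ≤ Φ q :=
      (ENNReal.le_div_iff_mul_le (Or.inr (by
        intro h0
        rw [h0] at h2
        simp at h2)) (Or.inl (by simp))).1 h2.le
    have h4 : (|y| + |realConjugate Φ y| + 1) * q ≤ (Φ q).toReal := by
      have := ENNReal.toReal_mono hfin h3
      rwa [ENNReal.toReal_mul, ENNReal.toReal_ofReal (by positivity), ENNReal.coe_toReal] at this
    have h5 : q * y ≤ q * |y| := mul_le_mul_of_nonneg_left (le_abs_self y) q.2
    have h6 : |realConjugate Φ y| + 1 ≤ (|realConjugate Φ y| + 1) * q :=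
      le_mul_of_one_le_right (by positivity) h1
    have := neg_abs_le (realConjugate Φ y)
    linarith
  -- The shift by `N * |y|` makes the linear term nonnegative on `[0, N]`, so `ENNReal.ofReal`
  -- truncates nothing.
  have hlsc : LowerSemicontinuousOn
      (fun q : ℝ≥0 => Φ q + ENNReal.ofReal (N * |y| - q * y)) (Set.Icc 0 N) := by
    refine LowerSemicontinuous.lowerSemicontinuousOn ?_ _
    exact hΦ.lowerSemicontinuous.add
      (ENNReal.continuous_ofReal.comp (by fun_prop)).lowerSemicontinuous
  obtain ⟨q, hq, hmin⟩ := hlsc.exists_isMinOn ⟨0, by simp⟩ isCompact_Icc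
  have key : ∀ p : ℝ≥0, p ≤ N → 0 ≤ N * |y| - p * y := by
    intro p hp
    have h5 : p * y ≤ p * |y| := mul_le_mul_of_nonneg_left (le_abs_self y) p.2
    have h6 : p * |y| ≤ N * |y| :=
      mul_le_mul_of_nonneg_right (by exact_mod_cast hp) (abs_nonneg y)
    linarith
  have hone : Φ 1 ≠ ∞ := by
    have h1 : (1 : ℝ≥0) ∈ {x | Φ x < ∞} := interior_subset hΦ.one_mem_interior_dom
    exact ne_of_lt h1
  have hcmp : ∀ p : ℝ≥0, p ≤ N → Φ p ≠ ∞ →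
      Φ q ≠ ∞ ∧ p * y - (Φ p).toReal ≤ q * y - (Φ q).toReal := by
    intro p hp hpf
    have h1 : Φ q + ENNReal.ofReal (N * |y| - q * y) ≤ Φ p + ENNReal.ofReal (N * |y| - p * y) :=
      hmin ⟨zero_le, hp⟩
    have h2 : Φ p + ENNReal.ofReal (N * |y| - p * y) ≠ ∞ := by simp [hpf]
    have hqf : Φ q ≠ ∞ := by
      intro h
      rw [h] at h1
      simp [hpf] at h1
    refine ⟨hqf, ?_⟩
    have := ENNReal.toReal_mono h2 h1
    rw [ENNReal.toReal_add hqf (by simp), ENNReal.toReal_add hpf (by simp),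
      ENNReal.toReal_ofReal (key q hq.2), ENNReal.toReal_ofReal (key p hp)] at this
    linarith
  have hqf := (hcmp 1 (le_max_right _ _) hone).1
  refine ⟨q, mem_argmaxSet_iff.2 ⟨hqf, ?_⟩⟩
  have : realConjugate Φ y ≤ max (q * y - (Φ q).toReal) (realConjugate Φ y - 1) := by
    refine hΦ.realConjugate_le fun p hp => ?_
    rcases le_total p N with h | h
    · exact le_max_of_le_left (hcmp p h hp).2
    · exact le_max_of_le_right (hN p h hp)
  rcases le_max_iff.1 this with h | h <;> linarith

theorem IsDivergenceFunction.monotone_realConjugate (hΦ : IsDivergenceFunction Φ) :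
    Monotone (realConjugate Φ) := by
  intro y z hyz
  obtain ⟨q, hq⟩ := hΦ.argmaxSet_nonempty y
  have := hΦ.add_mul_sub_le hq z
  have : 0 ≤ q * (z - y) := mul_nonneg q.2 (by linarith)
  linarith

theorem IsDivergenceFunction.convexOn_realConjugate (hΦ : IsDivergenceFunction Φ) :
    ConvexOn ℝ Set.univ (realConjugate Φ) := by
  refine ⟨convex_univ, fun x _ y _ a b ha hb hab => ?_⟩
  simp only [smul_eq_mul]
  obtain ⟨q, hq⟩ := hΦ.argmaxSet_nonempty (a * x + b * y)
  have h1 := mul_le_mul_of_nonneg_left (hΦ.add_mul_sub_le hq x) ha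
  have h2 := mul_le_mul_of_nonneg_left (hΦ.add_mul_sub_le hq y) hb
  have : a * (realConjugate Φ (a * x + b * y) + q * (x - (a * x + b * y))) +
      b * (realConjugate Φ (a * x + b * y) + q * (y - (a * x + b * y))) =
      realConjugate Φ (a * x + b * y) := by
    obtain rfl : b = 1 - a := by linarith
    ring
  linarith

theorem IsDivergenceFunction.continuous_realConjugate (hΦ : IsDivergenceFunction Φ) :
    Continuous (realConjugate Φ) :=
  continuousOn_univ.1 (hΦ.convexOn_realConjugate.continuousOn isOpen_univ)

theorem IsDivergenceFunction.realConjugate_nonneg (hΦ : IsDivergenceFunction Φ) {y : ℝ}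
    (hy : 0 ≤ y) : 0 ≤ realConjugate Φ y := by
  refine le_trans ?_ (hΦ.monotone_realConjugate hy)
  refine le_of_forall_pos_le_add fun ε hε => ?_
  have : ⨅ x, Φ x < ENNReal.ofReal ε := by rw [hΦ.iInf_eq_zero]; simpa
  obtain ⟨q, hq⟩ := iInf_lt_iff.1 this
  have h1 := hΦ.mul_le_realConjugate_add (hq.trans ENNReal.ofReal_lt_top).ne 0
  have h2 := ENNReal.toReal_mono ENNReal.ofReal_ne_top hq.le
  rw [ENNReal.toReal_ofReal hε.le] at h2
  linarith

/-- Since `Φ` is finite at `1 + δ` and `1 - δ`, Fenchel-Young puts lines of slopes `δ` and `-δ`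
below `Φ* x - x`. -/
theorem IsDivergenceFunction.tendsto_realConjugate_sub (hΦ : IsDivergenceFunction Φ) :
    Tendsto (fun x => realConjugate Φ x - x) (cocompact ℝ) atTop := by
  have h1 := hΦ.one_mem_interior_dom
  rw [mem_interior_iff_mem_nhds, Metric.mem_nhds_iff] at h1
  obtain ⟨ε, hε, hball⟩ := h1
  set δ : ℝ := min (ε / 2) (1 / 2)
  have hδ : 0 < δ := by positivity
  have hδε : δ < ε := (min_le_left _ _).trans_lt (by linarith)
  have hδ1 : δ ≤ 1 / 2 := min_le_right _ _
  have hdom : ∀ r : ℝ, 0 ≤ r → |r - 1| < ε → Φ r.toNNReal ≠ ∞ := by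
    intro r hr h
    refine ne_of_lt (hball ?_)
    rwa [Metric.mem_ball, NNReal.dist_eq, Real.coe_toNNReal r hr, NNReal.coe_one]
  have hp := hdom (1 + δ) (by linarith) (by rwa [add_sub_cancel_left, abs_of_pos hδ])
  have hm := hdom (1 - δ) (by linarith) (by rwa [sub_sub_cancel_left, abs_neg, abs_of_pos hδ])
  set c := max (Φ (1 + δ).toNNReal).toReal (Φ (1 - δ).toNNReal).toReal
  have hlow : ∀ x : ℝ, δ * ‖x‖ - c ≤ realConjugate Φ x - x := by
    intro x
    have h1 := hΦ.mul_le_realConjugate_add hp x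
    have h2 := hΦ.mul_le_realConjugate_add hm x
    have h3 : (Φ (1 + δ).toNNReal).toReal ≤ c := le_max_left _ _
    have h4 : (Φ (1 - δ).toNNReal).toReal ≤ c := le_max_right _ _
    rw [Real.coe_toNNReal _ (by linarith)] at h1 h2
    rw [Real.norm_eq_abs]
    rcases abs_cases x with ⟨h, -⟩ | ⟨h, -⟩ <;> rw [h] <;> linarith
  refine tendsto_atTop_mono hlow ?_
  exact tendsto_atTop_add_const_right _ _
    ((tendsto_norm_cocompact_atTop (E := ℝ)).const_mul_atTop hδ)

theorem IsDivergenceFunction.toENNReal_conjugate (hΦ : IsDivergenceFunction Φ) (y : ℝ) :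
    (conjugate Φ y).toENNReal = ENNReal.ofReal (realConjugate Φ y) := by
  rw [← coe_realConjugate hΦ, EReal.toENNReal_of_ne_top (by simp), EReal.toReal_coe]

/-! ### Extreme maximizers -/

theorem IsDivergenceFunction.isClosed_graph_argmaxSet (hΦ : IsDivergenceFunction Φ) :
    IsClosed {p : ℝ × ℝ≥0 | p.2 ∈ argmaxSet Φ p.1} := by
  have hc := hΦ.continuous_realConjugate
  refine (isClosed_le (f := fun p : ℝ × ℝ≥0 => realConjugate Φ p.1) (g := fun p => p.2 * p.1)
    (by fun_prop) (by fun_prop)).inter ?_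
  exact hΦ.lowerSemicontinuous.isClosed_epigraph.preimage
    (f := fun p : ℝ × ℝ≥0 => (p.2, ENNReal.ofReal (p.2 * p.1 - realConjugate Φ p.1)))
    (continuous_snd.prodMk (ENNReal.continuous_ofReal.comp (by fun_prop)))

theorem IsDivergenceFunction.isClosed_argmaxSet (hΦ : IsDivergenceFunction Φ) (y : ℝ) :
    IsClosed (argmaxSet Φ y) :=
  hΦ.isClosed_graph_argmaxSet.preimage (f := fun q : ℝ≥0 => (y, q)) (by fun_prop)

/-- Monotonicity of subgradients: add the subgradient inequalities at `y` and `z`. -/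
theorem IsDivergenceFunction.le_of_mem_argmaxSet (hΦ : IsDivergenceFunction Φ) {y z : ℝ}
    {q r : ℝ≥0} (hyz : y < z) (hq : q ∈ argmaxSet Φ y) (hr : r ∈ argmaxSet Φ z) : q ≤ r := by
  have h1 := hΦ.add_mul_sub_le hq z
  have h2 := hΦ.add_mul_sub_le hr y
  have : (q : ℝ) * (z - y) ≤ r * (z - y) := by linarith
  exact_mod_cast le_of_mul_le_mul_right this (sub_pos.2 hyz)

theorem IsDivergenceFunction.bddAbove_argmaxSet (hΦ : IsDivergenceFunction Φ) (y : ℝ) :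
    BddAbove (argmaxSet Φ y) := by
  obtain ⟨r, hr⟩ := hΦ.argmaxSet_nonempty (y + 1)
  exact ⟨r, fun q hq => hΦ.le_of_mem_argmaxSet (by linarith) hq hr⟩

theorem IsDivergenceFunction.sSup_mem_argmaxSet (hΦ : IsDivergenceFunction Φ) (y : ℝ) :
    sSup (argmaxSet Φ y) ∈ argmaxSet Φ y :=
  (hΦ.isClosed_argmaxSet y).csSup_mem (hΦ.argmaxSet_nonempty y) (hΦ.bddAbove_argmaxSet y)

theorem IsDivergenceFunction.sInf_mem_argmaxSet (hΦ : IsDivergenceFunction Φ) (y : ℝ) :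
    sInf (argmaxSet Φ y) ∈ argmaxSet Φ y :=
  (hΦ.isClosed_argmaxSet y).csInf_mem (hΦ.argmaxSet_nonempty y) (OrderBot.bddBelow _)

theorem IsDivergenceFunction.monotone_sSup_argmaxSet (hΦ : IsDivergenceFunction Φ) :
    Monotone fun y => sSup (argmaxSet Φ y) := by
  intro y z hyz
  rcases hyz.eq_or_lt with rfl | h
  · rfl
  · exact hΦ.le_of_mem_argmaxSet h (hΦ.sSup_mem_argmaxSet y) (hΦ.sSup_mem_argmaxSet z)

theorem IsDivergenceFunction.monotone_sInf_argmaxSet (hΦ : IsDivergenceFunction Φ) :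
    Monotone fun y => sInf (argmaxSet Φ y) := by
  intro y z hyz
  rcases hyz.eq_or_lt with rfl | h
  · rfl
  · exact hΦ.le_of_mem_argmaxSet h (hΦ.sInf_mem_argmaxSet y) (hΦ.sInf_mem_argmaxSet z)

/-- The right limit exists by monotonicity, is a maximizer at `y` by the closed graph, and is no
smaller than the largest one. -/
theorem IsDivergenceFunction.tendsto_sSup_argmaxSet (hΦ : IsDivergenceFunction Φ) (y : ℝ) :
    Tendsto (fun z => sSup (argmaxSet Φ z)) (𝓝[>] y) (𝓝 (sSup (argmaxSet Φ y))) := by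
  have h := hΦ.monotone_sSup_argmaxSet.tendsto_nhdsGT y
  set l := sInf ((fun z => sSup (argmaxSet Φ z)) '' Set.Ioi y)
  have hl : l ∈ argmaxSet Φ y :=
    hΦ.isClosed_graph_argmaxSet.mem_of_tendsto
      ((tendsto_nhdsWithin_of_tendsto_nhds tendsto_id).prodMk_nhds h)
      (Eventually.of_forall fun z => hΦ.sSup_mem_argmaxSet z)
  have : l = sSup (argmaxSet Φ y) := by
    refine le_antisymm (le_csSup (hΦ.bddAbove_argmaxSet y) hl) ?_
    refine ge_of_tendsto h ?_
    filter_upwards [self_mem_nhdsWithin] with z hz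
    exact hΦ.monotone_sSup_argmaxSet (le_of_lt hz)
  rwa [this] at h

theorem IsDivergenceFunction.tendsto_sInf_argmaxSet (hΦ : IsDivergenceFunction Φ) (y : ℝ) :
    Tendsto (fun z => sInf (argmaxSet Φ z)) (𝓝[<] y) (𝓝 (sInf (argmaxSet Φ y))) := by
  have h := hΦ.monotone_sInf_argmaxSet.tendsto_nhdsLT y
  set l := sSup ((fun z => sInf (argmaxSet Φ z)) '' Set.Iio y)
  have hl : l ∈ argmaxSet Φ y :=
    hΦ.isClosed_graph_argmaxSet.mem_of_tendsto
      ((tendsto_nhdsWithin_of_tendsto_nhds tendsto_id).prodMk_nhds h)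
      (Eventually.of_forall fun z => hΦ.sInf_mem_argmaxSet z)
  have : l = sInf (argmaxSet Φ y) := by
    refine le_antisymm ?_ (csInf_le (OrderBot.bddBelow _) hl)
    refine le_of_tendsto h ?_
    filter_upwards [self_mem_nhdsWithin] with z hz
    exact hΦ.monotone_sInf_argmaxSet (le_of_lt hz)
  rwa [this] at h

theorem IsDivergenceFunction.convex_argmaxSet (hΦ : IsDivergenceFunction Φ) {y : ℝ} {p q a b : ℝ≥0}
    (hp : p ∈ argmaxSet Φ y) (hq : q ∈ argmaxSet Φ y) (hab : a + b = 1) :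
    a * p + b * q ∈ argmaxSet Φ y := by
  rw [mem_argmaxSet_iff] at hp hq ⊢
  have h := hΦ.convexOn.2 (Set.mem_univ p) (Set.mem_univ q) (zero_le (a := a)) (zero_le (a := b))
    hab
  have hf : a • Φ p + b • Φ q ≠ ∞ := by
    simp [ENNReal.smul_def, ENNReal.mul_eq_top, hp.1, hq.1]
  refine ⟨ne_top_of_le_ne_top hf h, ?_⟩
  have h2 := ENNReal.toReal_mono hf h
  rw [ENNReal.toReal_add (by simp [ENNReal.smul_def, ENNReal.mul_eq_top, hp.1])
    (by simp [ENNReal.smul_def, ENNReal.mul_eq_top, hq.1])] at h2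
  simp only [ENNReal.smul_def, smul_eq_mul, ENNReal.toReal_mul, ENNReal.coe_toReal] at h2
  have hab' : (b : ℝ) = 1 - a := by
    have : (a : ℝ) + b = 1 := by exact_mod_cast hab
    linarith
  have h3 := mul_le_mul_of_nonneg_left hp.2 a.2
  have h4 := mul_le_mul_of_nonneg_left hq.2 b.2
  simp only [NNReal.val_eq_coe] at h3 h4
  push_cast
  rw [hab'] at h2 h4 ⊢
  linarith

variable {Φ : ℝ≥0 → ℝ≥0∞}

/-! ### Integrability from the Orlicz heart -/

section Integrability

variable {Ω : Type*} [MeasurableSpace Ω] {P : Measure Ω}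

/-- Convexity separates the shift from the variable: `x + c * |X|` lies below the midpoint of `2 *
|x|` and `2 * (c + 1) * |X|`. -/
theorem MemOrliczHeart.integrable_realConjugate [IsFiniteMeasure P] (hΦ : IsDivergenceFunction Φ)
    {X : Ω → ℝ} (hX : MemOrliczHeart (conjugate Φ) X P) (x : ℝ) {c : ℝ} (hc : 0 ≤ c) :
    Integrable (fun ω => realConjugate Φ (x + c * |X ω|)) P := by
  have hcont := hΦ.continuous_realConjugate
  have hmeas : ∀ a b : ℝ, AEStronglyMeasurable (fun ω => realConjugate Φ (a + b * |X ω|)) P :=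
    fun a b => (hcont.measurable.comp_aemeasurable
      ((hX.1.abs.const_mul b).const_add a)).aestronglyMeasurable
  -- Using `c + 1` keeps the factor positive when `c = 0`, as the Orlicz heart condition requires.
  have hint : Integrable (fun ω => realConjugate Φ (2 * (c + 1) * |X ω|)) P := by
    refine ⟨by simpa using hmeas 0 (2 * (c + 1)), ?_⟩
    rw [hasFiniteIntegral_iff_ofReal (Eventually.of_forall fun ω =>
      hΦ.realConjugate_nonneg (by positivity))]
    simpa only [hΦ.toENNReal_conjugate] using hX.2 (2 * (c + 1)) (by positivity)
  refine Integrable.mono' ((integrable_const (|realConjugate Φ x| + |realConjugate Φ (2 * |x|)|)).add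
    hint) (hmeas x c) (Eventually.of_forall fun ω => ?_)
  have hw : 0 ≤ |X ω| := abs_nonneg _
  have h1 : realConjugate Φ x ≤ realConjugate Φ (x + c * |X ω|) :=
    hΦ.monotone_realConjugate (by nlinarith)
  have h2 : realConjugate Φ (x + c * |X ω|) ≤
      realConjugate Φ ((1 / 2 : ℝ) • (2 * |x|) + (1 / 2 : ℝ) • (2 * (c + 1) * |X ω|)) := by
    refine hΦ.monotone_realConjugate ?_
    simp only [smul_eq_mul]
    linarith [le_abs_self x]
  have h3 := hΦ.convexOn_realConjugate.2 (Set.mem_univ (2 * |x|))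
    (Set.mem_univ (2 * (c + 1) * |X ω|)) (show (0 : ℝ) ≤ 1 / 2 by norm_num)
    (show (0 : ℝ) ≤ 1 / 2 by norm_num) (by norm_num)
  simp only [smul_eq_mul] at h2 h3
  have h4 : 0 ≤ realConjugate Φ (2 * (c + 1) * |X ω|) := hΦ.realConjugate_nonneg (by positivity)
  have h5 := abs_nonneg (realConjugate Φ x)
  have h6 := le_abs_self (realConjugate Φ (2 * |x|))
  have h7 := neg_abs_le (realConjugate Φ x)
  have h8 := abs_nonneg (realConjugate Φ (2 * |x|))
  rw [Real.norm_eq_abs]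
  simp only [Pi.add_apply]
  exact abs_le.2 ⟨by linarith, by linarith⟩

theorem IsDivergenceFunction.integrable_realConjugate_of_le [IsFiniteMeasure P]
    (hΦ : IsDivergenceFunction Φ)
    {Z X : Ω → ℝ} (hZ : AEMeasurable Z P) (hZ0 : ∀ ω, 0 ≤ Z ω) (hZX : ∀ᵐ ω ∂P, Z ω ≤ |X ω|)
    (x : ℝ) {c : ℝ} (hc : 0 ≤ c) (hX : Integrable (fun ω => realConjugate Φ (x + c * |X ω|)) P) :
    Integrable (fun ω => realConjugate Φ (x + c * Z ω)) P := by
  refine Integrable.mono' ((integrable_const |realConjugate Φ x|).add hX.norm)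
    (hΦ.continuous_realConjugate.measurable.comp_aemeasurable
      ((hZ.const_mul c).const_add x)).aestronglyMeasurable ?_
  filter_upwards [hZX] with ω hω
  have h1 : realConjugate Φ x ≤ realConjugate Φ (x + c * Z ω) :=
    hΦ.monotone_realConjugate (by nlinarith [hZ0 ω])
  have h2 : realConjugate Φ (x + c * Z ω) ≤ realConjugate Φ (x + c * |X ω|) :=
    hΦ.monotone_realConjugate (by nlinarith [hZ0 ω])
  simp only [Pi.add_apply, Real.norm_eq_abs]
  have h3 := le_abs_self (realConjugate Φ (x + c * |X ω|))
  have h4 := neg_abs_le (realConjugate Φ x)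
  have h5 := abs_nonneg (realConjugate Φ x)
  have h6 := abs_nonneg (realConjugate Φ (x + c * |X ω|))
  exact abs_le.2 ⟨by linarith, by linarith⟩

end Integrability

/-! ### Duality for a fixed random variable -/

section Duality

variable {Ω : Type*} {m0 : MeasurableSpace Ω} {P : Measure Ω}

/-- A subgradient is at most the increment of `Φ*` over the next unit step, which is integrable. -/
theorem IsDivergenceFunction.integrable_of_mem_argmaxSet (hΦ : IsDivergenceFunction Φ) {Z : Ω → ℝ}
    (hint : ∀ x : ℝ, Integrable (fun ω => realConjugate Φ (x + Z ω)) P) {x : ℝ} {q : Ω → ℝ≥0}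
    (hqm : AEMeasurable q P) (hq : ∀ ω, q ω ∈ argmaxSet Φ (x + Z ω)) :
    Integrable (fun ω => (q ω : ℝ)) P := by
  refine Integrable.mono' ((hint (x + 1)).sub (hint x))
    hqm.coe_nnreal_real.aestronglyMeasurable (Eventually.of_forall fun ω => ?_)
  have := hΦ.add_mul_sub_le (hq ω) (x + 1 + Z ω)
  simp only [Real.norm_eq_abs, NNReal.abs_eq, Pi.sub_apply]
  linarith

variable [IsProbabilityMeasure P]

theorem IsDivergenceFunction.sub_le_integral (hΦ : IsDivergenceFunction Φ) {Z : Ω → ℝ}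
    (hZ0 : ∀ ω, 0 ≤ Z ω) {x : ℝ} (hint : Integrable (fun ω => realConjugate Φ (x + Z ω) - x) P) :
    realConjugate Φ x - x ≤ ∫ ω, (realConjugate Φ (x + Z ω) - x) ∂P :=
  calc realConjugate Φ x - x = ∫ _, (realConjugate Φ x - x) ∂P := by simp
    _ ≤ _ := integral_mono (integrable_const _) hint fun ω => by
      have := hΦ.monotone_realConjugate (show x ≤ x + Z ω by linarith [hZ0 ω])
      simpa using this

/-- The objective is finite and convex, hence continuous, and dominates the coercive function `Φ* x
- x` because `Z ≥ 0`. -/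
theorem IsDivergenceFunction.exists_isMinOn (hΦ : IsDivergenceFunction Φ) {Z : Ω → ℝ}
    (hZ0 : ∀ ω, 0 ≤ Z ω) (hint : ∀ x : ℝ, Integrable (fun ω => realConjugate Φ (x + Z ω)) P) :
    ∃ x₀ : ℝ, ∀ x, ∫ ω, (realConjugate Φ (x₀ + Z ω) - x₀) ∂P ≤
      ∫ ω, (realConjugate Φ (x + Z ω) - x) ∂P := by
  have hint' : ∀ x : ℝ, Integrable (fun ω => realConjugate Φ (x + Z ω) - x) P :=
    fun x => (hint x).sub (integrable_const x)
  have hconv : ConvexOn ℝ Set.univ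
      (fun x : ℝ => ∫ ω, (realConjugate Φ (x + Z ω) - x) ∂P) := by
    refine ⟨convex_univ, fun x _ y _ a b ha hb hab => ?_⟩
    simp only [smul_eq_mul]
    rw [← integral_const_mul, ← integral_const_mul, ← integral_add ((hint' x).const_mul a)
      ((hint' y).const_mul b)]
    refine integral_mono (hint' _) (((hint' x).const_mul a).add ((hint' y).const_mul b))
      fun ω => ?_
    have h := hΦ.convexOn_realConjugate.2 (Set.mem_univ (x + Z ω)) (Set.mem_univ (y + Z ω))
      ha hb hab
    simp only [smul_eq_mul] at h
    have e : a * (x + Z ω) + b * (y + Z ω) = a * x + b * y + Z ω := by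
      linear_combination Z ω * hab
    rw [e] at h
    simp only
    linarith
  have hcont : Continuous (fun x : ℝ => ∫ ω, (realConjugate Φ (x + Z ω) - x) ∂P) :=
    continuousOn_univ.1 (hconv.continuousOn isOpen_univ)
  refine hcont.exists_forall_le (tendsto_atTop_mono (fun x => ?_) hΦ.tendsto_realConjugate_sub)
  exact hΦ.sub_le_integral hZ0 (hint' x)

/-- First-order optimality at the minimizer, with the extreme subgradients in the role of one-sided
derivatives. -/
theorem IsDivergenceFunction.exists_density (hΦ : IsDivergenceFunction Φ) {Z : Ω → ℝ}
    (hZm : Measurable Z) (hZ0 : ∀ ω, 0 ≤ Z ω)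
    (hint : ∀ x : ℝ, Integrable (fun ω => realConjugate Φ (x + Z ω)) P) :
    ∃ (x₀ : ℝ) (q : Ω → ℝ≥0), Measurable q ∧ Integrable (fun ω => (q ω : ℝ)) P ∧
      ∫ ω, (q ω : ℝ) ∂P = 1 ∧ ∀ ω, q ω ∈ argmaxSet Φ (x₀ + Z ω) := by
  obtain ⟨x₀, hx₀⟩ := hΦ.exists_isMinOn hZ0 hint
  have hx₀' : ∀ x, x - x₀ ≤ ∫ ω, (realConjugate Φ (x + Z ω) - realConjugate Φ (x₀ + Z ω)) ∂P := by
    intro x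
    have := hx₀ x
    rw [integral_sub (hint _) (integrable_const _), integral_sub (hint _) (integrable_const _)]
      at this
    rw [integral_sub (hint _) (hint _)]
    simp only [integral_const, probReal_univ, one_smul] at this
    linarith
  set b : ℝ → Ω → ℝ≥0 := fun x ω => sSup (argmaxSet Φ (x + Z ω))
  set a : ℝ → Ω → ℝ≥0 := fun x ω => sInf (argmaxSet Φ (x + Z ω))
  have hbm : ∀ x, Measurable (b x) :=
    fun x => hΦ.monotone_sSup_argmaxSet.measurable.comp (hZm.const_add x)
  have ham : ∀ x, Measurable (a x) :=
    fun x => hΦ.monotone_sInf_argmaxSet.measurable.comp (hZm.const_add x)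
  have hbA : ∀ x ω, b x ω ∈ argmaxSet Φ (x + Z ω) := fun x ω => hΦ.sSup_mem_argmaxSet _
  have haA : ∀ x ω, a x ω ∈ argmaxSet Φ (x + Z ω) := fun x ω => hΦ.sInf_mem_argmaxSet _
  have hbi := fun x => hΦ.integrable_of_mem_argmaxSet hint (hbm x).aemeasurable (hbA x)
  have hai := fun x => hΦ.integrable_of_mem_argmaxSet hint (ham x).aemeasurable (haA x)
  -- For `x > x₀`, minimality and the subgradient inequality at `x` give mean at least `1`; then `x
  -- ↓ x₀`, dominated by the subgradient at `x₀ + 1`.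
  have hb1 : 1 ≤ ∫ ω, (b x₀ ω : ℝ) ∂P := by
    have hlim : Tendsto (fun x => ∫ ω, (b x ω : ℝ) ∂P) (𝓝[>] x₀) (𝓝 (∫ ω, (b x₀ ω : ℝ) ∂P)) := by
      refine tendsto_integral_filter_of_dominated_convergence (fun ω => (b (x₀ + 1) ω : ℝ))
        (Eventually.of_forall fun x => (hbm x).coe_nnreal_real.aestronglyMeasurable) ?_
        (hbi _) (Eventually.of_forall fun ω => ?_)
      · filter_upwards [Ioo_mem_nhdsGT (show x₀ < x₀ + 1 by linarith)] with x hx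
        refine Eventually.of_forall fun ω => ?_
        simp only [Real.norm_eq_abs, NNReal.abs_eq, NNReal.coe_le_coe]
        exact hΦ.monotone_sSup_argmaxSet (by linarith [hx.2])
      · refine (NNReal.continuous_coe.tendsto _).comp
          ((hΦ.tendsto_sSup_argmaxSet (x₀ + Z ω)).comp ?_)
        refine tendsto_nhdsWithin_iff.2 ⟨tendsto_nhdsWithin_of_tendsto_nhds
          ((continuous_id.add continuous_const).tendsto x₀), ?_⟩
        filter_upwards [self_mem_nhdsWithin] with x hx
        have : x₀ < x := hx
        simpa
    refine ge_of_tendsto hlim ?_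
    filter_upwards [self_mem_nhdsWithin] with x hx
    have hx : x₀ < x := hx
    have h1 : ∫ ω, (realConjugate Φ (x + Z ω) - realConjugate Φ (x₀ + Z ω)) ∂P ≤
        ∫ ω, (b x ω : ℝ) * (x - x₀) ∂P := by
      refine integral_mono ((hint _).sub (hint _)) ((hbi x).mul_const _) fun ω => ?_
      have := hΦ.add_mul_sub_le (hbA x ω) (x₀ + Z ω)
      simp only
      linarith
    rw [integral_mul_const] at h1
    have := (hx₀' x).trans h1
    nlinarith
  -- The mirror argument for `x ↑ x₀`; here `a x₀` itself dominates.
  have ha1 : ∫ ω, (a x₀ ω : ℝ) ∂P ≤ 1 := by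
    have hlim : Tendsto (fun x => ∫ ω, (a x ω : ℝ) ∂P) (𝓝[<] x₀) (𝓝 (∫ ω, (a x₀ ω : ℝ) ∂P)) := by
      refine tendsto_integral_filter_of_dominated_convergence (fun ω => (a x₀ ω : ℝ))
        (Eventually.of_forall fun x => (ham x).coe_nnreal_real.aestronglyMeasurable) ?_
        (hai _) (Eventually.of_forall fun ω => ?_)
      · filter_upwards [self_mem_nhdsWithin] with x hx
        have hx : x < x₀ := hx
        refine Eventually.of_forall fun ω => ?_
        simp only [Real.norm_eq_abs, NNReal.abs_eq, NNReal.coe_le_coe]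
        exact hΦ.monotone_sInf_argmaxSet (by linarith)
      · refine (NNReal.continuous_coe.tendsto _).comp
          ((hΦ.tendsto_sInf_argmaxSet (x₀ + Z ω)).comp ?_)
        refine tendsto_nhdsWithin_iff.2 ⟨tendsto_nhdsWithin_of_tendsto_nhds
          ((continuous_id.add continuous_const).tendsto x₀), ?_⟩
        filter_upwards [self_mem_nhdsWithin] with x hx
        have : x < x₀ := hx
        simpa
    refine le_of_tendsto hlim ?_
    filter_upwards [self_mem_nhdsWithin] with x hx
    have hx : x < x₀ := hx
    have h1 : ∫ ω, (a x ω : ℝ) * (x₀ - x) ∂P ≤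
        ∫ ω, -(realConjugate Φ (x + Z ω) - realConjugate Φ (x₀ + Z ω)) ∂P := by
      refine integral_mono ((hai x).mul_const _) ((hint _).sub (hint _)).neg fun ω => ?_
      have := hΦ.add_mul_sub_le (haA x ω) (x₀ + Z ω)
      simp only
      linarith
    rw [integral_mul_const, integral_neg] at h1
    have := hx₀' x
    nlinarith
  obtain ⟨s, t, hs, ht, hst, hsum⟩ : (1 : ℝ) ∈ segment ℝ (∫ ω, (a x₀ ω : ℝ) ∂P)
      (∫ ω, (b x₀ ω : ℝ) ∂P) := by
    rw [segment_eq_Icc (ha1.trans hb1)]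
    exact ⟨ha1, hb1⟩
  lift s to ℝ≥0 using hs
  lift t to ℝ≥0 using ht
  refine ⟨x₀, fun ω => s * a x₀ ω + t * b x₀ ω, by fun_prop, ?_, ?_, fun ω => ?_⟩
  · push_cast
    exact ((hai x₀).const_mul _).add ((hbi x₀).const_mul _)
  · push_cast
    rw [integral_add ((hai x₀).const_mul _) ((hbi x₀).const_mul _), integral_const_mul,
      integral_const_mul]
    simpa using hsum
  · exact hΦ.convex_argmaxSet (haA _ _) (hbA _ _) (by exact_mod_cast hst)

/-- Integrate Fenchel-Young at the density of `Q`, whose mean `1` turns the term `x * dQ/dP` into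
`x`; the case `x = 0` gives integrability. -/
theorem IsDivergenceFunction.integrable_and_integral_sub_le (hΦ : IsDivergenceFunction Φ)
    {Z : Ω → ℝ} (hZm : Measurable Z) (hZ0 : ∀ ω, 0 ≤ Z ω)
    (hint : ∀ x : ℝ, Integrable (fun ω => realConjugate Φ (x + Z ω)) P)
    {Q : Measure Ω} [IsProbabilityMeasure Q] (hQP : Q ≪ P)
    (hQ : ∫⁻ ω, Φ (Q.rnDeriv P ω).toNNReal ∂P < ∞) :
    Integrable Z Q ∧ ∀ x : ℝ,
      ∫ ω, Z ω ∂Q - (∫⁻ ω, Φ (Q.rnDeriv P ω).toNNReal ∂P).toReal ≤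
        ∫ ω, (realConjugate Φ (x + Z ω) - x) ∂P := by
  have hΦm : Measurable fun ω => Φ (Q.rnDeriv P ω).toNNReal :=
    hΦ.lowerSemicontinuous.measurable.comp (Measure.measurable_rnDeriv Q P).ennreal_toNNReal
  have hfin : ∀ᵐ ω ∂P, Φ (Q.rnDeriv P ω).toNNReal < ∞ := ae_lt_top hΦm hQ.ne
  have hΦi : Integrable (fun ω => (Φ (Q.rnDeriv P ω).toNNReal).toReal) P :=
    integrable_toReal_of_lintegral_ne_top hΦm.aemeasurable hQ.ne
  have hYoung : ∀ x : ℝ, ∀ᵐ ω ∂P, (Q.rnDeriv P ω).toReal * (x + Z ω) ≤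
      realConjugate Φ (x + Z ω) + (Φ (Q.rnDeriv P ω).toNNReal).toReal := by
    intro x
    filter_upwards [hfin] with ω hω
    exact hΦ.mul_le_realConjugate_add hω.ne _
  have hqi : Integrable (fun ω => (Q.rnDeriv P ω).toReal) P := Measure.integrable_toReal_rnDeriv
  have hqZ : Integrable (fun ω => (Q.rnDeriv P ω).toReal * Z ω) P := by
    refine Integrable.mono' ((hint 0).add hΦi)
      ((Measure.measurable_rnDeriv Q P).ennreal_toReal.mul hZm).aestronglyMeasurable ?_
    filter_upwards [hYoung 0] with ω hω
    rw [Real.norm_of_nonneg (mul_nonneg ENNReal.toReal_nonneg (hZ0 ω))]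
    simpa using hω
  refine ⟨(integrable_rnDeriv_smul_iff hQP).1 hqZ, fun x => ?_⟩
  have h1 : ∫ ω, Z ω ∂Q = ∫ ω, (Q.rnDeriv P ω).toReal * Z ω ∂P :=
    (integral_rnDeriv_smul hQP).symm
  have h2 : ∫ ω, (Q.rnDeriv P ω).toReal ∂P = 1 := by
    rw [Measure.integral_toReal_rnDeriv hQP, probReal_univ]
  have h3 : ∫ ω, (Φ (Q.rnDeriv P ω).toNNReal).toReal ∂P =
      (∫⁻ ω, Φ (Q.rnDeriv P ω).toNNReal ∂P).toReal :=
    integral_toReal hΦm.aemeasurable hfin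
  have h4 := integral_mono_ae ((hqi.const_mul x).add hqZ) ((hint x).add hΦi)
    (by filter_upwards [hYoung x] with ω hω; simp only [Pi.add_apply]; linarith)
  rw [integral_add' (hqi.const_mul x) hqZ, integral_add' (hint x) hΦi, integral_const_mul, h2, h3]
    at h4
  rw [h1, integral_sub (hint x) (integrable_const x), integral_const, probReal_univ, one_smul]
  linarith

/-- The density from `exists_density` gives pointwise equality in Fenchel-Young. -/
theorem IsDivergenceFunction.exists_measure_integral_sub_eq (hΦ : IsDivergenceFunction Φ)
    {Z : Ω → ℝ} (hZm : Measurable Z) (hZ0 : ∀ ω, 0 ≤ Z ω)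
    (hint : ∀ x : ℝ, Integrable (fun ω => realConjugate Φ (x + Z ω)) P)
    (hint2 : ∀ x : ℝ, Integrable (fun ω => realConjugate Φ (x + 2 * Z ω)) P) :
    ∃ (x₀ : ℝ) (Q : Measure Ω), IsProbabilityMeasure Q ∧ Q ≪ P ∧
      ∫⁻ ω, Φ (Q.rnDeriv P ω).toNNReal ∂P < ∞ ∧
      ∫ ω, Z ω ∂Q - (∫⁻ ω, Φ (Q.rnDeriv P ω).toNNReal ∂P).toReal =
        ∫ ω, (realConjugate Φ (x₀ + Z ω) - x₀) ∂P := by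
  obtain ⟨x₀, q, hqm, hqi, hq1, hqA⟩ := hΦ.exists_density hZm hZ0 hint
  -- A subgradient step of length `Z` bounds `q * Z` by `Φ* (x₀ + 2 * Z) - Φ* (x₀ + Z)`; this is
  -- what `hint2` is for.
  have hqZ : Integrable (fun ω => (q ω : ℝ) * Z ω) P := by
    refine Integrable.mono' ((hint2 x₀).sub (hint x₀))
      (hqm.coe_nnreal_real.mul hZm).aestronglyMeasurable (Eventually.of_forall fun ω => ?_)
    have := hΦ.add_mul_sub_le (hqA ω) (x₀ + 2 * Z ω)
    rw [Real.norm_of_nonneg (mul_nonneg (NNReal.coe_nonneg _) (hZ0 ω)), Pi.sub_apply]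
    linarith
  have hlint : ∫⁻ ω, (q ω : ℝ≥0∞) ∂P = 1 := by
    rw [lintegral_coe_eq_integral _ hqi, hq1, ENNReal.ofReal_one]
  have hrn : (P.withDensity fun ω => (q ω : ℝ≥0∞)).rnDeriv P =ᵐ[P] fun ω => (q ω : ℝ≥0∞) :=
    Measure.rnDeriv_withDensity P hqm.coe_nnreal_ennreal
  have hΦq : ∫⁻ ω, Φ ((P.withDensity fun ω => (q ω : ℝ≥0∞)).rnDeriv P ω).toNNReal ∂P =
      ∫⁻ ω, Φ (q ω) ∂P := by
    refine lintegral_congr_ae ?_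
    filter_upwards [hrn] with ω hω
    rw [hω, ENNReal.toNNReal_coe]
  have hval : ∀ ω, (Φ (q ω)).toReal = x₀ * q ω + q ω * Z ω - realConjugate Φ (x₀ + Z ω) := by
    intro ω
    rw [hΦ.eq_of_mem_argmaxSet (hqA ω)]
    ring
  have hΦi : Integrable (fun ω => x₀ * q ω + q ω * Z ω - realConjugate Φ (x₀ + Z ω)) P :=
    ((hqi.const_mul x₀).add hqZ).sub (hint x₀)
  have hnn : ∀ ω, 0 ≤ x₀ * q ω + q ω * Z ω - realConjugate Φ (x₀ + Z ω) := fun ω => by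
    rw [← hval ω]
    exact ENNReal.toReal_nonneg
  have hΦl : ∫⁻ ω, Φ (q ω) ∂P =
      ENNReal.ofReal (∫ ω, (x₀ * q ω + q ω * Z ω - realConjugate Φ (x₀ + Z ω)) ∂P) := by
    rw [ofReal_integral_eq_lintegral_ofReal hΦi
      (Eventually.of_forall hnn)]
    refine lintegral_congr fun ω => ?_
    rw [← hval ω, ENNReal.ofReal_toReal (mem_argmaxSet_iff.1 (hqA ω)).1]
  refine ⟨x₀, P.withDensity fun ω => (q ω : ℝ≥0∞), ⟨?_⟩, withDensity_absolutelyContinuous _ _,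
    ?_, ?_⟩
  · rw [withDensity_apply _ MeasurableSet.univ, Measure.restrict_univ, hlint]
  · rw [hΦq, hΦl]
    exact ENNReal.ofReal_lt_top
  · have hZQ : ∫ ω, Z ω ∂(P.withDensity fun ω => (q ω : ℝ≥0∞)) = ∫ ω, (q ω : ℝ) * Z ω ∂P :=
      integral_withDensity_eq_integral_smul hqm _
    have hsum : ∫ ω, (x₀ * q ω + q ω * Z ω - realConjugate Φ (x₀ + Z ω)) ∂P =
        x₀ * ∫ ω, (q ω : ℝ) ∂P + ∫ ω, (q ω : ℝ) * Z ω ∂P -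
          ∫ ω, realConjugate Φ (x₀ + Z ω) ∂P := by
      rw [← integral_const_mul, ← integral_add (hqi.const_mul x₀) hqZ]
      exact integral_sub (f := fun ω => x₀ * q ω + q ω * Z ω) ((hqi.const_mul x₀).add hqZ)
        (hint x₀)
    rw [hΦq, hΦl, ENNReal.toReal_ofReal (integral_nonneg hnn), hZQ, hsum, hq1,
      integral_sub (hint x₀) (integrable_const x₀), integral_const, probReal_univ, one_smul]
    ring

end Duality

/-! ### Splitting integrals on atomless spaces -/

section Splitting

variable {Ω : Type*} {m m0 : MeasurableSpace Ω} {P : Measure Ω}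

theorem mem_iff_of_mapNatBool_eq {α : Type*} [MeasurableSpace α] [MeasurableSpace.CountablyGenerated α]
    {x y : α}
    (hxy : MeasurableSpace.mapNatBool α x = MeasurableSpace.mapNatBool α y) {B : Set α}
    (hB : MeasurableSet B) : x ∈ B ↔ y ∈ B := by
  rw [← MeasurableSpace.generateFrom_natGeneratingSequence α] at hB
  induction B, hB using MeasurableSpace.generateFrom_induction with
  | hC t ht _ =>
    obtain ⟨n, rfl⟩ := ht
    exact decide_eq_decide.1 (congr_fun hxy n)
  | empty => simp
  | compl t _ ih => simp [ih]
  | iUnion s _ ih => simp [ih]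

/-- Encode a countable generating sequence of `m'` in one real variable. Sets of `m'` contain or
miss each fiber entirely, so a fiber of positive measure would be an atom of `m`. -/
theorem exists_measurable_forall_measure_fiber_eq_zero
    (hat : AtomlessOn P m) (hgen : CountablyGeneratedModNull P m) :
    ∃ X : Ω → ℝ, Measurable[m] X ∧ ∀ c, P (X ⁻¹' {c}) = 0 := by
  obtain ⟨m', hm', hcg, happrox⟩ := hgen
  have hemb := measurableEmbedding_embeddingReal (ℕ → Bool)
  have hf : Measurable[m'] (@MeasurableSpace.mapNatBool Ω m' hcg) :=
    @MeasurableSpace.measurable_mapNatBool Ω m' hcg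
  have hX : Measurable[m'] (fun ω => embeddingReal (ℕ → Bool) (@MeasurableSpace.mapNatBool Ω m' hcg ω)) :=
    hemb.measurable.comp hf
  refine ⟨_, hX.mono hm' le_rfl, fun c => ?_⟩
  set D := (fun ω => embeddingReal (ℕ → Bool) (@MeasurableSpace.mapNatBool Ω m' hcg ω)) ⁻¹' {c}
  have hD : MeasurableSet[m'] D := hX (measurableSet_singleton c)
  by_contra hne
  obtain ⟨B, hBD, hB, hB0, hBlt⟩ := hat D (hm' _ hD) (pos_iff_ne_zero.2 hne)
  obtain ⟨B', hB', hBB'⟩ := happrox B hB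
  have hdich : B' ∩ D = ∅ ∨ B' ∩ D = D := by
    rcases Set.eq_empty_or_nonempty (B' ∩ D) with h | ⟨x, hx, hxD⟩
    · exact Or.inl h
    · refine Or.inr (Set.inter_eq_right.2 fun y hyD => ?_)
      refine (@mem_iff_of_mapNatBool_eq Ω m' hcg x y (hemb.injective ?_) B' hB').1 hx
      have h1 : embeddingReal (ℕ → Bool) (@MeasurableSpace.mapNatBool Ω m' hcg x) = c := hxD
      have h2 : embeddingReal (ℕ → Bool) (@MeasurableSpace.mapNatBool Ω m' hcg y) = c := hyD
      rw [h1, h2]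
  have hP : P B = P (B' ∩ D) := by
    rw [← Set.inter_eq_left.2 hBD]
    exact measure_congr (hBB'.inter (ae_eq_refl D))
  rcases hdich with h | h <;> rw [h] at hP
  · simp [hP] at hB0
  · exact hBlt.ne hP

/-- Intermediate value theorem: the distribution function of `X` under `P` restricted to `D` is
continuous because `X` has null fibers. -/
theorem exists_measureReal_inter_Iic_eq [IsFiniteMeasure P] {X : Ω → ℝ} (hX : Measurable X)
    (hX0 : ∀ c, P (X ⁻¹' {c}) = 0) (D : Set Ω) {r : ℝ} (hr0 : 0 < r)
    (hr1 : r < 1) : ∃ t, P.real (X ⁻¹' Set.Iic t ∩ D) = r * P.real D := by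
  rcases eq_or_ne (P.real D) 0 with hPD | hPD
  · exact ⟨0, by rw [hPD, mul_zero]; exact measureReal_mono_null Set.inter_subset_right hPD⟩
  have hPD : 0 < P.real D := lt_of_le_of_ne measureReal_nonneg hPD.symm
  set ν := (P.restrict D).map X
  have hν : ∀ t, ν.real (Set.Iic t) = P.real (X ⁻¹' Set.Iic t ∩ D) := fun t => by
    rw [measureReal_def, Measure.map_apply hX measurableSet_Iic,
      Measure.restrict_apply (hX measurableSet_Iic), measureReal_def]
  have hνu : ν.real Set.univ = P.real D := by
    rw [measureReal_def, Measure.map_apply hX MeasurableSet.univ, Set.preimage_univ,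
      Measure.restrict_apply_univ, measureReal_def]
  have : NullSingletonClass ν := ⟨fun c => by
    rw [Measure.map_apply hX (measurableSet_singleton c)]
    exact le_antisymm ((Measure.restrict_apply_le _ _).trans (hX0 c).le) zero_le⟩
  have hcont : Continuous fun t => ν.real (Set.Iic t) := by
    have h : ∀ t, ν.real (Set.Iic t) = ∫ _ in Set.Iic t, (1 : ℝ) ∂ν := fun t => by simp
    simp_rw [h]
    refine continuous_iff_continuousAt.2 fun t => ?_
    exact (IntegrableOn.continuousOn_Iic_primitive_Iic (a₀ := t + 1)
      (integrable_const 1).integrableOn).continuousAt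
      (Iic_mem_nhds (by linarith))
  have hbot : Tendsto (fun t => ν.real (Set.Iic t)) atBot (𝓝 0) := by
    have := tendsto_measure_iInter_atBot (μ := ν) (s := fun t : ℝ => Set.Iic t)
      (fun t => measurableSet_Iic.nullMeasurableSet) (fun _ _ h => Set.Iic_subset_Iic.2 h)
      ⟨0, measure_ne_top _ _⟩
    have hempty : ⋂ t : ℝ, Set.Iic t = ∅ := by
      refine Set.eq_empty_of_forall_notMem fun x hx => ?_
      have := Set.mem_iInter.1 hx (x - 1)
      simp only [Set.mem_Iic] at this
      linarith
    rw [hempty, measure_empty] at this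
    exact (ENNReal.tendsto_toReal ENNReal.zero_ne_top).comp this
  have htop : Tendsto (fun t => ν.real (Set.Iic t)) atTop (𝓝 (P.real D)) := by
    rw [← hνu]
    exact (ENNReal.tendsto_toReal (measure_ne_top _ _)).comp (tendsto_measure_Iic_atTop ν)
  obtain ⟨t₁, ht₁⟩ := (hbot.eventually (gt_mem_nhds (mul_pos hr0 hPD))).exists
  obtain ⟨t₂, ht₂⟩ := (htop.eventually (lt_mem_nhds (show r * P.real D < P.real D by nlinarith))).exists
  obtain ⟨t, ht⟩ := mem_range_of_exists_le_of_exists_ge hcont ⟨t₁, ht₁.le⟩ ⟨t₂, ht₂.le⟩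
  exact ⟨t, by rw [← hν]; exact ht⟩

/-- An approximate Lyapunov theorem, valid in infinite dimensions: replace `f` by a simple function
close in `L¹` and split each of its level sets in the exact ratio `r`. -/
theorem exists_norm_setIntegral_sub_lt [IsFiniteMeasure P] {E : Type*} [NormedAddCommGroup E]
    [NormedSpace ℝ E] [CompleteSpace E] {X : Ω → ℝ}
    (hX : Measurable X) (hX0 : ∀ c, P (X ⁻¹' {c}) = 0) {f : Ω → E} (hf : Integrable f P)
    {r : ℝ} (hr0 : 0 < r) (hr1 : r < 1) {ε : ℝ} (hε : 0 < ε) :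
    ∃ A, MeasurableSet A ∧ ‖∫ ω in A, f ω ∂P - r • ∫ ω, f ω ∂P‖ < ε := by
  obtain ⟨s, hs, hsL⟩ := (memLp_one_iff_integrable.2 hf).exists_simpleFunc_eLpNorm_sub_lt
    ENNReal.one_ne_top (ε := ENNReal.ofReal (ε / 2)) (by simpa using hε)
  have hsi : Integrable s P := memLp_one_iff_integrable.1 hsL
  have hdi : Integrable (fun ω => f ω - s ω) P := hf.sub hsi
  have hδ : ∫ ω, ‖f ω - s ω‖ ∂P < ε / 2 := by
    rw [integral_norm_eq_lintegral_enorm hdi.aestronglyMeasurable]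
    rw [eLpNorm_one_eq_lintegral_enorm] at hs
    exact ENNReal.toReal_lt_of_lt_ofReal hs
  choose t ht using fun c : E => exists_measureReal_inter_Iic_eq hX hX0 (s ⁻¹' {c}) hr0 hr1
  -- The threshold varies with the value of `s`, so one set splits all level sets at once.
  set A := {ω | X ω ≤ t (s ω)}
  have hA : MeasurableSet A := measurableSet_le hX (s.map t).measurable
  refine ⟨A, hA, ?_⟩
  have hsA : ∫ ω in A, s ω ∂P = r • ∫ ω, s ω ∂P := by
    rw [s.integral_eq_sum hsi.integrableOn, s.integral_eq_sum hsi, Finset.smul_sum]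
    refine Finset.sum_congr rfl fun c _ => ?_
    rw [smul_smul, ← ht c, measureReal_restrict_apply (s.measurableSet_fiber c)]
    congr 2
    ext ω
    simp only [Set.mem_inter_iff, Set.mem_preimage, Set.mem_singleton_iff, Set.mem_Iic, A,
      Set.mem_ofPred_eq]
    constructor
    · rintro ⟨h, h'⟩; exact ⟨h ▸ h', h⟩
    · rintro ⟨h, h'⟩; exact ⟨h', h' ▸ h⟩
  have hsplit : ∫ ω in A, f ω ∂P - r • ∫ ω, f ω ∂P =
      ∫ ω in A, (f ω - s ω) ∂P - r • ∫ ω, (f ω - s ω) ∂P := by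
    rw [integral_sub hf.integrableOn hsi.integrableOn, integral_sub hf hsi, hsA, smul_sub]
    abel
  rw [hsplit]
  have hb1 : ‖∫ ω in A, (f ω - s ω) ∂P‖ ≤ ∫ ω, ‖f ω - s ω‖ ∂P :=
    (norm_integral_le_integral_norm _).trans
      (setIntegral_le_integral hdi.norm (Eventually.of_forall fun _ => norm_nonneg _))
  have hb2 : ‖r • ∫ ω, (f ω - s ω) ∂P‖ ≤ ∫ ω, ‖f ω - s ω‖ ∂P := by
    rw [norm_smul, Real.norm_of_nonneg hr0.le]
    exact (mul_le_of_le_one_left (norm_nonneg _) hr1.le).trans (norm_integral_le_integral_norm _)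
  linarith [norm_sub_le (∫ ω in A, (f ω - s ω) ∂P) (r • ∫ ω, (f ω - s ω) ∂P)]

/-- The conditional expectation of `f` has the same integrals over `m`-measurable sets, so the
splitting can be done inside `m`. -/
theorem exists_norm_setIntegral_sub_lt_of_le [IsFiniteMeasure P] {E : Type*}
    [NormedAddCommGroup E] [NormedSpace ℝ E] [CompleteSpace E] (hm : m ≤ m0) {X : Ω → ℝ}
    (hX : Measurable[m] X) (hX0 : ∀ c, P (X ⁻¹' {c}) = 0) {f : Ω → E} (hf : Integrable f P)
    {r : ℝ} (hr0 : 0 < r) (hr1 : r < 1) {ε : ℝ} (hε : 0 < ε) :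
    ∃ A, MeasurableSet[m] A ∧ ‖∫ ω in A, f ω ∂P - r • ∫ ω, f ω ∂P‖ < ε := by
  obtain ⟨A, hA, h⟩ := @exists_norm_setIntegral_sub_lt Ω m (P.trim hm) _ E _ _ _ X hX
    (fun c => by rw [trim_measurableSet_eq hm (hX (measurableSet_singleton c))]; exact hX0 c)
    (P[f|m]) (integrable_condExp.trim hm stronglyMeasurable_condExp) r hr0 hr1 ε hε
  refine ⟨A, hA, ?_⟩
  rwa [← setIntegral_trim hm stronglyMeasurable_condExp hA,
    ← integral_trim hm stronglyMeasurable_condExp, setIntegral_condExp hm hf hA,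
    integral_condExp hm] at h

end Splitting

/-! ### Measurability of stopped values -/

section Measurability

/-- Grid approximation of `t`: `c = 1` approaches from the right, `c = 0` from the left. -/
theorem tendsto_projIcc_floor {a b : ℝ} (h : a ≤ b) {t : ℝ} (ht : 0 ≤ t) (c : ℝ) :
    Tendsto (fun n : ℕ => Set.projIcc a b h ((⌊((n : ℝ) + 1) * t⌋₊ + c) / ((n : ℝ) + 1))) atTop
      (𝓝 (Set.projIcc a b h t)) := by
  have hn : Tendsto (fun n : ℕ => (n : ℝ) + 1) atTop atTop :=
    tendsto_atTop_add_const_right _ _ tendsto_natCast_atTop_atTop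
  have h1 := (tendsto_nat_floor_mul_div_atTop ht).comp hn
  have h2 : Tendsto (fun n : ℕ => c / ((n : ℝ) + 1)) atTop (𝓝 0) := hn.const_div_atTop c
  have h3 := h1.add h2
  rw [add_zero] at h3
  refine (continuous_projIcc.tendsto t).comp (h3.congr fun n => ?_)
  simp only [Function.comp_apply]
  rw [mul_comm, add_div]

variable {Ω : Type*} {m0 : MeasurableSpace Ω} {T : ℝ}

/-- Rounding time up to a grid leaves countably many values, so joint measurability is clear;
right-continuity passes to the limit. -/
theorem measurable_uncurry_of_rightContinuous (hT : 0 ≤ T) {Y : Set.Icc (0 : ℝ) T → Ω → ℝ}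
    (hY : ∀ t, Measurable (Y t))
    (hYrc : ∀ ω t, ContinuousWithinAt (fun s => Y s ω) (Set.Ioi t) t) :
    Measurable fun p : Set.Icc (0 : ℝ) T × Ω => Y p.1 p.2 := by
  refine measurable_of_tendsto_metrizable (f := fun (n : ℕ) (p : Set.Icc (0 : ℝ) T × Ω) =>
    Y (Set.projIcc 0 T hT ((⌊((n : ℝ) + 1) * p.1⌋₊ + 1) / ((n : ℝ) + 1))) p.2) (fun n => ?_) ?_
  · have h : Measurable fun p : ℕ × Ω =>
        Y (Set.projIcc 0 T hT ((p.1 + 1) / ((n : ℝ) + 1))) p.2 :=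
      measurable_from_prod_countable_right fun k => hY (Set.projIcc 0 T hT (((k : ℝ) + 1) / ((n : ℝ) + 1)))
    exact h.comp (f := fun p : Set.Icc (0 : ℝ) T × Ω => (⌊((n : ℝ) + 1) * (p.1 : ℝ)⌋₊, p.2))
      ((Nat.measurable_floor.comp
        ((measurable_subtype_coe.comp measurable_fst).const_mul _)).prodMk measurable_snd)
  · rw [tendsto_pi_nhds]
    rintro ⟨t, ω⟩
    have hlim := tendsto_projIcc_floor hT t.2.1 1
    rw [Set.projIcc_val] at hlim
    have hc : Tendsto (fun s => Y s ω) (𝓝[≥] t) (𝓝 (Y t ω)) :=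
      continuousWithinAt_Ioi_iff_Ici.1 (hYrc ω t)
    refine hc.comp (tendsto_nhdsWithin_iff.2 ⟨hlim, Eventually.of_forall fun n => ?_⟩)
    have hle : (t : ℝ) ≤ (⌊((n : ℝ) + 1) * t⌋₊ + 1) / ((n : ℝ) + 1) := by
      rw [le_div_iff₀ (by positivity), mul_comm]
      exact (Nat.lt_floor_add_one _).le
    have := Set.monotone_projIcc hT hle
    rwa [Set.projIcc_val] at this

theorem measurable_uncurry_of_leftContinuous {α : Type*} [TopologicalSpace α]
    [TopologicalSpace.PseudoMetrizableSpace α] [MeasurableSpace α] [BorelSpace α]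
    {τ : Ω → unitInterval → α} (hτ : ∀ u, Measurable fun ω => τ ω u)
    (hlc : ∀ ω u, ContinuousWithinAt (τ ω) (Set.Iio u) u) :
    Measurable fun p : Ω × unitInterval => τ p.1 p.2 := by
  refine measurable_of_tendsto_metrizable (f := fun (n : ℕ) (p : Ω × unitInterval) =>
    τ p.1 (Set.projIcc 0 1 zero_le_one ((⌊((n : ℝ) + 1) * p.2⌋₊ + 0) / ((n : ℝ) + 1))))
    (fun n => ?_) ?_
  · have h : Measurable fun p : Ω × ℕ =>
        τ p.1 (Set.projIcc 0 1 zero_le_one ((p.2 + 0) / ((n : ℝ) + 1))) :=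
      measurable_from_prod_countable_left fun k =>
        hτ (Set.projIcc 0 1 zero_le_one (((k : ℝ) + 0) / ((n : ℝ) + 1)))
    exact h.comp (f := fun p : Ω × unitInterval => (p.1, ⌊((n : ℝ) + 1) * (p.2 : ℝ)⌋₊))
      (measurable_fst.prodMk (Nat.measurable_floor.comp
        ((measurable_subtype_coe.comp measurable_snd).const_mul _)))
  · rw [tendsto_pi_nhds]
    rintro ⟨ω, u⟩
    have hlim := tendsto_projIcc_floor zero_le_one u.2.1 0
    rw [Set.projIcc_val] at hlim
    have hc : Tendsto (τ ω) (𝓝[≤] u) (𝓝 (τ ω u)) := continuousWithinAt_Iio_iff_Iic.1 (hlc ω u)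
    refine hc.comp (tendsto_nhdsWithin_iff.2 ⟨hlim, Eventually.of_forall fun n => ?_⟩)
    have hle : (⌊((n : ℝ) + 1) * u⌋₊ + 0) / ((n : ℝ) + 1) ≤ (u : ℝ) := by
      rw [div_le_iff₀ (by positivity), add_zero, mul_comm (u : ℝ)]
      exact Nat.floor_le (mul_nonneg (by positivity) u.2.1)
    have := Set.monotone_projIcc zero_le_one hle
    rwa [Set.projIcc_val] at this

variable {F : Filtration (Set.Icc (0 : ℝ) T) m0}

theorem measurable_of_mem_stoppingTimes {τ : Ω → Set.Icc (0 : ℝ) T} (hτ : τ ∈ stoppingTimes F) :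
    Measurable τ := by
  refine measurable_of_Iic fun i => F.le i _ ?_
  have := IsStoppingTime.measurableSet_le hτ i
  simp only [WithTop.coe_le_coe] at this
  exact this

theorem max_mem_stoppingTimes {τ : Ω → Set.Icc (0 : ℝ) T} (hτ : τ ∈ stoppingTimes F)
    (c : Set.Icc (0 : ℝ) T) : (fun ω => max (τ ω) c) ∈ stoppingTimes F := by
  have := IsStoppingTime.max_const hτ c
  simpa only [stoppingTimes, Set.mem_ofPred_eq, WithTop.coe_max] using this

open Classical in
theorem piecewise_mem_stoppingTimes {σ τ : Ω → Set.Icc (0 : ℝ) T} (hσ : σ ∈ stoppingTimes F)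
    (hτ : τ ∈ stoppingTimes F) {c : Set.Icc (0 : ℝ) T} (hσc : ∀ ω, c ≤ σ ω) (hτc : ∀ ω, c ≤ τ ω)
    {A : Set Ω} (hA : MeasurableSet[F c] A) : A.piecewise σ τ ∈ stoppingTimes F := by
  have := IsStoppingTime.piecewise_of_le hσ hτ (fun ω => WithTop.coe_le_coe.2 (hσc ω))
    (fun ω => WithTop.coe_le_coe.2 (hτc ω)) hA
  have heq : (fun ω => ((A.piecewise σ τ ω : Set.Icc (0 : ℝ) T) : WithTop (Set.Icc (0 : ℝ) T))) =
      A.piecewise (fun ω => (σ ω : WithTop _)) (fun ω => (τ ω : WithTop _)) := by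
    ext1 ω
    by_cases h : ω ∈ A <;> simp [h]
  change IsStoppingTime F _
  rw [heq]
  exact this

variable {Y : Set.Icc (0 : ℝ) T → Ω → ℝ}

theorem measurable_stopped (hT : 0 ≤ T) (hY : ∀ t, Measurable (Y t))
    (hYrc : ∀ ω t, ContinuousWithinAt (fun s => Y s ω) (Set.Ioi t) t)
    {τ : Ω → Set.Icc (0 : ℝ) T} (hτ : τ ∈ stoppingTimes F) : Measurable fun ω => Y (τ ω) ω :=
  (measurable_uncurry_of_rightContinuous hT hY hYrc).comp
    ((measurable_of_mem_stoppingTimes hτ).prodMk measurable_id)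

theorem measurable_randomized_stopped (hT : 0 ≤ T) (hY : ∀ t, Measurable (Y t))
    (hYrc : ∀ ω t, ContinuousWithinAt (fun s => Y s ω) (Set.Ioi t) t)
    {τ : Ω → unitInterval → Set.Icc (0 : ℝ) T} (hτ : τ ∈ randomizedStoppingTimes F) :
    Measurable fun p : Ω × unitInterval => Y (τ p.1 p.2) p.1 :=
  (measurable_uncurry_of_rightContinuous hT hY hYrc).comp
    ((measurable_uncurry_of_leftContinuous (fun u => measurable_of_mem_stoppingTimes (hτ.2.2 u))
      hτ.2.1).prodMk measurable_fst)

end Measurability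

/-! ### Approximation of randomized stopping times -/

section Approximation

variable {Ω : Type*} {m0 : MeasurableSpace Ω} {P : Measure Ω} {T : ℝ}
  {F : Filtration (Set.Icc (0 : ℝ) T) m0} {Y : Set.Icc (0 : ℝ) T → Ω → ℝ}
  {E : Type*} [NormedAddCommGroup E] {G : ℝ → E} {B : Ω → ℝ}

theorem integrable_comp_stopped (hT : 0 ≤ T) (hY : ∀ t, Measurable (Y t))
    (hYrc : ∀ ω t, ContinuousWithinAt (fun s => Y s ω) (Set.Ioi t) t) (hG : Continuous G)
    (hB : Integrable B P) (hGB : ∀ᵐ ω ∂P, ∀ t, ‖G (Y t ω)‖ ≤ B ω)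
    {τ : Ω → Set.Icc (0 : ℝ) T} (hτ : τ ∈ stoppingTimes F) :
    Integrable (fun ω => G (Y (τ ω) ω)) P := by
  refine Integrable.mono' hB (hG.comp_aestronglyMeasurable
    (measurable_stopped hT hY hYrc hτ).aestronglyMeasurable) ?_
  filter_upwards [hGB] with ω hω using hω _

variable [NormedSpace ℝ E]

/-- The expectations of `G (Y τ)` over the stopping times `τ` that are bounded away from `0`. -/
def positiveValues (P : Measure Ω) (F : Filtration (Set.Icc (0 : ℝ) T) m0)
    (Y : Set.Icc (0 : ℝ) T → Ω → ℝ) (G : ℝ → E) : Set E :=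
  {v | ∃ τ ∈ stoppingTimes F, (∃ c : Set.Icc (0 : ℝ) T, 0 < (c : ℝ) ∧ ∀ ω, c ≤ τ ω) ∧
    ∫ ω, G (Y (τ ω) ω) ∂P = v}

/-- The times `max τ (c n)` tend to `τ` from the right as `c n → 0`; use right-continuity of `Y` and
dominated convergence. -/
theorem integral_stopped_mem_closure (hT : 0 < T) (hY : ∀ t, Measurable (Y t))
    (hYrc : ∀ ω t, ContinuousWithinAt (fun s => Y s ω) (Set.Ioi t) t) (hG : Continuous G)
    (hB : Integrable B P) (hGB : ∀ᵐ ω ∂P, ∀ t, ‖G (Y t ω)‖ ≤ B ω)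
    {τ : Ω → Set.Icc (0 : ℝ) T} (hτ : τ ∈ stoppingTimes F) :
    ∫ ω, G (Y (τ ω) ω) ∂P ∈ closure (positiveValues P F Y G) := by
  set c : ℕ → Set.Icc (0 : ℝ) T := fun n => Set.projIcc 0 T hT.le (1 / ((n : ℝ) + 1))
  have hc0 : ∀ n, 0 < (c n : ℝ) := by
    intro n
    simp only [c, Set.coe_projIcc]
    exact lt_max_of_lt_right (lt_min hT (by positivity))
  have hclim : Tendsto c atTop (𝓝 ⟨0, le_rfl, hT.le⟩) := by
    have := (continuous_projIcc (h := hT.le)).tendsto (0 : ℝ) |>.comp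
      tendsto_one_div_add_atTop_nhds_zero_nat
    rwa [Set.projIcc_left] at this
  refine mem_closure_of_tendsto (b := atTop)
    (f := fun n => ∫ ω, G (Y (max (τ ω) (c n)) ω) ∂P) ?_ (Eventually.of_forall fun n =>
      ⟨_, max_mem_stoppingTimes hτ (c n), ⟨c n, hc0 n, fun ω => le_max_right _ _⟩, rfl⟩)
  refine tendsto_integral_of_dominated_convergence B (fun n =>
    (integrable_comp_stopped hT.le hY hYrc hG hB hGB
      (max_mem_stoppingTimes hτ (c n))).aestronglyMeasurable) hB (fun n => ?_)
    (Eventually.of_forall fun ω => ?_)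
  · filter_upwards [hGB] with ω hω using hω _
  · refine (hG.tendsto _).comp ?_
    have hr : Tendsto (fun s => Y s ω) (𝓝[≥] (τ ω)) (𝓝 (Y (τ ω) ω)) :=
      continuousWithinAt_Ioi_iff_Ici.1 (hYrc ω (τ ω))
    refine hr.comp (tendsto_nhdsWithin_iff.2 ⟨?_, Eventually.of_forall fun n => Set.mem_Ici.2 (le_max_left _ _)⟩)
    have h := (tendsto_const_nhds (x := τ ω)).max hclim
    rwa [max_eq_left (show (⟨0, le_rfl, hT.le⟩ : Set.Icc (0 : ℝ) T) ≤ τ ω from (τ ω).2.1)] at h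

variable [IsProbabilityMeasure P] [CompleteSpace E]

open Classical in
-- Paste `σ` and `τ` along an event known at a positive time preceding both. Atomlessness is only
-- available at positive times, hence the restriction to times bounded away from `0`.
theorem convex_closure_positiveValues (hT : 0 ≤ T) (hY : ∀ t, Measurable (Y t))
    (hYrc : ∀ ω t, ContinuousWithinAt (fun s => Y s ω) (Set.Ioi t) t) (hG : Continuous G)
    (hB : Integrable B P) (hGB : ∀ᵐ ω ∂P, ∀ t, ‖G (Y t ω)‖ ≤ B ω)
    (hatomless : ∀ t : Set.Icc (0 : ℝ) T, 0 < (t : ℝ) → AtomlessOn P (F t))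
    (hgen : ∀ t : Set.Icc (0 : ℝ) T, 0 < (t : ℝ) → CountablyGeneratedModNull P (F t)) :
    Convex ℝ (closure (positiveValues P F Y G)) := by
  rw [convex_iff_forall_pos]
  intro x hx y hy a b ha hb hab
  -- By continuity it now suffices to mix two elements of `positiveValues` and land in the closure.
  rw [← closure_closure]
  refine map_mem_closure₂ (f := fun x y => a • x + b • y) (by fun_prop) hx hy ?_
  rintro _ ⟨σ, hσ, ⟨c₁, hc₁, hσc⟩, rfl⟩ _ ⟨τ, hτ, ⟨c₂, hc₂, hτc⟩, rfl⟩
  rw [Metric.mem_closure_iff]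
  intro ε hε
  have hc : 0 < ((min c₁ c₂ : Set.Icc (0 : ℝ) T) : ℝ) := by
    rcases min_choice c₁ c₂ with h | h <;> rw [h] <;> assumption
  obtain ⟨X, hX, hX0⟩ := exists_measurable_forall_measure_fiber_eq_zero (hatomless _ hc) (hgen _ hc)
  have hσi := integrable_comp_stopped hT hY hYrc hG hB hGB hσ
  have hτi := integrable_comp_stopped hT hY hYrc hG hB hGB hτ
  -- Splitting the difference suffices: pasting adds its integral over `A` to the expectation for
  -- `τ`.
  obtain ⟨A, hA, hAε⟩ := exists_norm_setIntegral_sub_lt_of_le (F.le _) hX hX0 (hσi.sub hτi)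
    ha (by linarith : a < 1) hε
  have hA' : MeasurableSet A := F.le _ _ hA
  have hmem : A.piecewise σ τ ∈ stoppingTimes F :=
    piecewise_mem_stoppingTimes hσ hτ (fun ω => (min_le_left _ _).trans (hσc ω))
      (fun ω => (min_le_right _ _).trans (hτc ω)) hA
  refine ⟨_, ⟨_, hmem, ⟨min c₁ c₂, hc, fun ω => ?_⟩, rfl⟩, ?_⟩
  · by_cases h : ω ∈ A
    · simpa [h] using Or.inl (hσc ω)
    · simpa [h] using Or.inr (hτc ω)
  · have hpw : (fun ω => G (Y (A.piecewise σ τ ω) ω)) =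
        A.piecewise (fun ω => G (Y (σ ω) ω)) (fun ω => G (Y (τ ω) ω)) := by
      ext1 ω
      by_cases h : ω ∈ A <;> simp [h]
    have hcompl := integral_add_compl hA' hτi
    rw [hpw, integral_piecewise hA' hσi.integrableOn hτi.integrableOn, dist_comm, dist_eq_norm]
    rw [integral_sub' hσi.integrableOn hτi.integrableOn, integral_sub' hσi hτi] at hAε
    refine lt_of_eq_of_lt (congrArg norm ?_) hAε
    obtain rfl : b = 1 - a := by linarith
    rw [← hcompl]
    module

/-- By Fubini the integral is an average over `u` of points of a closed convex set, hence stays in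
it. -/
theorem integral_randomized_mem_closure (hT : 0 < T) (hY : ∀ t, Measurable (Y t))
    (hYrc : ∀ ω t, ContinuousWithinAt (fun s => Y s ω) (Set.Ioi t) t) (hG : Continuous G)
    (hB : Integrable B P) (hGB : ∀ᵐ ω ∂P, ∀ t, ‖G (Y t ω)‖ ≤ B ω)
    (hatomless : ∀ t : Set.Icc (0 : ℝ) T, 0 < (t : ℝ) → AtomlessOn P (F t))
    (hgen : ∀ t : Set.Icc (0 : ℝ) T, 0 < (t : ℝ) → CountablyGeneratedModNull P (F t))
    {τ : Ω → unitInterval → Set.Icc (0 : ℝ) T} (hτ : τ ∈ randomizedStoppingTimes F) :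
    Integrable (fun p : Ω × unitInterval => G (Y (τ p.1 p.2) p.1)) (P.prod volume) ∧
    ∫ p : Ω × unitInterval, G (Y (τ p.1 p.2) p.1) ∂(P.prod volume) ∈
      closure (positiveValues P F Y G) := by
  have hint : Integrable (fun p : Ω × unitInterval => G (Y (τ p.1 p.2) p.1)) (P.prod volume) := by
    refine Integrable.mono' (hB.comp_fst volume) (hG.comp_aestronglyMeasurable
      (measurable_randomized_stopped hT.le hY hYrc hτ).aestronglyMeasurable) ?_
    filter_upwards [Measure.quasiMeasurePreserving_fst.ae hGB] with p hp using hp _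
  refine ⟨hint, ?_⟩
  rw [integral_prod_symm _ hint]
  exact (convex_closure_positiveValues hT.le hY hYrc hG hB hGB hatomless hgen).integral_mem
    isClosed_closure (Eventually.of_forall fun u =>
      integral_stopped_mem_closure hT hY hYrc hG hB hGB (hτ.2.2 u)) hint.integral_prod_right

end Approximation

/-! ### The optimal value -/

section Value

variable {Φ : ℝ≥0 → ℝ≥0∞}

/-- The function `x ↦ Φ* (x + y) - x` restricted to `[-R, R]`, depending continuously on `y`. -/
noncomputable def IsDivergenceFunction.shiftedConjugate (hΦ : IsDivergenceFunction Φ) (R : ℝ) :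
    C(ℝ, C(Set.Icc (-R) R, ℝ)) :=
  ContinuousMap.curry ⟨fun p : ℝ × Set.Icc (-R) R => realConjugate Φ (p.2 + p.1) - p.2, by
    have := hΦ.continuous_realConjugate
    fun_prop⟩

theorem IsDivergenceFunction.shiftedConjugate_apply (hΦ : IsDivergenceFunction Φ) (R y : ℝ)
    (x : Set.Icc (-R) R) : hΦ.shiftedConjugate R y x = realConjugate Φ (x + y) - x := rfl

theorem IsDivergenceFunction.norm_shiftedConjugate_le (hΦ : IsDivergenceFunction Φ) {R y s : ℝ}
    (hR : 0 ≤ R) (hy : 0 ≤ y) (hys : y ≤ s) :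
    ‖hΦ.shiftedConjugate R y‖ ≤ |realConjugate Φ (-R)| + R + |realConjugate Φ (R + s)| := by
  refine (ContinuousMap.norm_le _ (by positivity)).2 fun x => ?_
  rw [hΦ.shiftedConjugate_apply, Real.norm_eq_abs]
  have h1 : realConjugate Φ (-R) ≤ realConjugate Φ (x + y) :=
    hΦ.monotone_realConjugate (by linarith [x.2.1])
  have h2 : realConjugate Φ (x + y) ≤ realConjugate Φ (R + s) :=
    hΦ.monotone_realConjugate (by linarith [x.2.2])
  have h3 := neg_abs_le (realConjugate Φ (-R))
  have h4 := le_abs_self (realConjugate Φ (R + s))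
  have h5 := abs_nonneg (realConjugate Φ (-R))
  have h6 := abs_nonneg (realConjugate Φ (R + s))
  exact abs_le.2 ⟨by linarith [x.2.2], by linarith [x.2.1]⟩

variable {Ω : Type*} {m0 : MeasurableSpace Ω} {P : Measure Ω} [IsProbabilityMeasure P] {T : ℝ}
  {F : Filtration (Set.Icc (0 : ℝ) T) m0} {Y : Set.Icc (0 : ℝ) T → Ω → ℝ} {S : Ω → ℝ}

theorem IsDivergenceFunction.exists_radius (hΦ : IsDivergenceFunction Φ) (C : ℝ) :
    ∃ R, 0 ≤ R ∧ ∀ x, x ∉ Set.Icc (-R) R → C ≤ realConjugate Φ x - x := by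
  obtain ⟨K, hK, hKC⟩ := mem_cocompact.1
    (hΦ.tendsto_realConjugate_sub.eventually (eventually_ge_atTop C))
  obtain ⟨R, hR⟩ := hK.isBounded.subset_closedBall 0
  refine ⟨max R 0, le_max_right _ _, fun x hx => hKC fun hxK => hx ?_⟩
  have := hR hxK
  rw [mem_closedBall_zero_iff, Real.norm_eq_abs] at this
  exact abs_le.1 (this.trans (le_max_left _ _))

theorem IsDivergenceFunction.integrable_stopped (hΦ : IsDivergenceFunction Φ) (hT : 0 ≤ T)
    (hY0 : ∀ t ω, 0 ≤ Y t ω) (hY : ∀ t, Measurable (Y t))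
    (hYrc : ∀ ω t, ContinuousWithinAt (fun s => Y s ω) (Set.Ioi t) t)
    (hYS : ∀ᵐ ω ∂P, ∀ t, Y t ω ≤ |S ω|)
    (hS : ∀ x c : ℝ, 0 ≤ c → Integrable (fun ω => realConjugate Φ (x + c * |S ω|)) P)
    {τ : Ω → Set.Icc (0 : ℝ) T} (hτ : τ ∈ stoppingTimes F) (x : ℝ) {c : ℝ} (hc : 0 ≤ c) :
    Integrable (fun ω => realConjugate Φ (x + c * Y (τ ω) ω)) P :=
  hΦ.integrable_realConjugate_of_le (measurable_stopped hT hY hYrc hτ).aemeasurable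
    (fun ω => hY0 _ ω) (by filter_upwards [hYS] with ω hω using hω _) x hc (hS x c hc)

theorem IsDivergenceFunction.integrable_randomized_stopped (hΦ : IsDivergenceFunction Φ)
    (hT : 0 ≤ T) (hY0 : ∀ t ω, 0 ≤ Y t ω) (hY : ∀ t, Measurable (Y t))
    (hYrc : ∀ ω t, ContinuousWithinAt (fun s => Y s ω) (Set.Ioi t) t)
    (hYS : ∀ᵐ ω ∂P, ∀ t, Y t ω ≤ |S ω|)
    (hS : ∀ x c : ℝ, 0 ≤ c → Integrable (fun ω => realConjugate Φ (x + c * |S ω|)) P)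
    {τ : Ω → unitInterval → Set.Icc (0 : ℝ) T} (hτ : τ ∈ randomizedStoppingTimes F) (x : ℝ) :
    Integrable (fun p : Ω × unitInterval => realConjugate Φ (x + Y (τ p.1 p.2) p.1))
      (P.prod volume) := by
  have h := hΦ.integrable_realConjugate_of_le (P := P.prod (volume : Measure unitInterval))
    (X := fun p => S p.1)
    (measurable_randomized_stopped hT hY hYrc hτ).aemeasurable (fun p => hY0 _ _)
    (by filter_upwards [Measure.quasiMeasurePreserving_fst.ae hYS] with p hp using hp _)
    x zero_le_one ((hS x 1 zero_le_one).comp_fst volume)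
  simpa only [one_mul] using h

theorem IsDivergenceFunction.iInf_randomized_le (hΦ : IsDivergenceFunction Φ) (hT : 0 < T)
    (hY0 : ∀ t ω, 0 ≤ Y t ω) (hY : ∀ t, Measurable (Y t))
    (hYrc : ∀ ω t, ContinuousWithinAt (fun s => Y s ω) (Set.Ioi t) t)
    (hYS : ∀ᵐ ω ∂P, ∀ t, Y t ω ≤ |S ω|)
    (hS : ∀ x c : ℝ, 0 ≤ c → Integrable (fun ω => realConjugate Φ (x + c * |S ω|)) P)
    (hatomless : ∀ t : Set.Icc (0 : ℝ) T, 0 < (t : ℝ) → AtomlessOn P (F t))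
    (hgen : ∀ t : Set.Icc (0 : ℝ) T, 0 < (t : ℝ) → CountablyGeneratedModNull P (F t))
    {τ : Ω → unitInterval → Set.Icc (0 : ℝ) T} (hτ : τ ∈ randomizedStoppingTimes F) :
    ⨅ x : ℝ, ((∫ p : Ω × unitInterval,
        (realConjugate Φ (x + Y (τ p.1 p.2) p.1) - x) ∂(P.prod volume) : ℝ) : EReal) ≤
      ⨆ σ ∈ stoppingTimes F, ⨅ x : ℝ,
        ((∫ ω, (realConjugate Φ (x + Y (σ ω) ω) - x) ∂P : ℝ) : EReal) := by
  -- This constant bounds the objective at `x = 0` for every stopping time, so one radius `R` serves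
  -- them all.
  obtain ⟨R, hR, hRC⟩ := hΦ.exists_radius (∫ ω, realConjugate Φ |S ω| ∂P)
  have hB : Integrable (fun ω => |realConjugate Φ (-R)| + R + |realConjugate Φ (R + |S ω|)|) P := by
    have := (hS R 1 zero_le_one).abs
    simp only [one_mul] at this
    exact (integrable_const _).add this
  have hGB : ∀ᵐ ω ∂P, ∀ t, ‖hΦ.shiftedConjugate R (Y t ω)‖ ≤
      |realConjugate Φ (-R)| + R + |realConjugate Φ (R + |S ω|)| := by
    filter_upwards [hYS] with ω hω t
    exact hΦ.norm_shiftedConjugate_le hR (hY0 t ω) (hω t)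
  have hG := (hΦ.shiftedConjugate R).continuous
  obtain ⟨hint, hmem⟩ := integral_randomized_mem_closure hT hY hYrc hG hB hGB hatomless hgen hτ
  refine EReal.ge_of_forall_gt_iff_ge.1 fun r hr => ?_
  obtain ⟨r', hrr', hr'⟩ := EReal.lt_iff_exists_real_btwn.1 hr
  have hrr' : r < r' := EReal.coe_lt_coe_iff.1 hrr'
  have hr' : ∀ x : ℝ, r' ≤ ∫ p : Ω × unitInterval,
      (realConjugate Φ (x + Y (τ p.1 p.2) p.1) - x) ∂(P.prod volume) := fun x =>
    EReal.coe_le_coe_iff.1 (hr'.le.trans (iInf_le _ x))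
  -- The gap between `r` and `r'` absorbs the sup-norm error on `[-R, R]`.
  obtain ⟨_, ⟨σ, hσ, -, rfl⟩, hdist⟩ := Metric.mem_closure_iff.1 hmem (r' - r) (sub_pos.2 hrr')
  have hσint : Integrable (fun ω => hΦ.shiftedConjugate R (Y (σ ω) ω)) P :=
    integrable_comp_stopped hT.le hY hYrc hG hB hGB hσ
  have hσint' : ∀ x : ℝ, Integrable (fun ω => realConjugate Φ (x + Y (σ ω) ω)) P := fun x => by
    simpa only [one_mul] using hΦ.integrable_stopped hT.le hY0 hY hYrc hYS hS hσ x zero_le_one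
  have hK : ∀ x ∈ Set.Icc (-R) R, r ≤ ∫ ω, (realConjugate Φ (x + Y (σ ω) ω) - x) ∂P := by
    intro x hx
    have h := (ContinuousMap.dist_apply_le_dist ⟨x, hx⟩).trans_lt hdist
    rw [ContinuousMap.integral_apply hint, ContinuousMap.integral_apply hσint,
      Real.dist_eq] at h
    simp only [hΦ.shiftedConjugate_apply] at h
    linarith [(abs_lt.1 h).2, hr' x]
  refine le_iSup₂_of_le σ hσ (le_iInf fun x => EReal.coe_le_coe_iff.2 ?_)
  by_cases hx : x ∈ Set.Icc (-R) R
  · exact hK x hx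
  -- Outside `[-R, R]` the objective is at least its value at `0`, which already exceeds or equals
  -- `r`.
  · have h0 := hK 0 ⟨by linarith, hR⟩
    have h1 : ∫ ω, (realConjugate Φ (0 + Y (σ ω) ω) - 0) ∂P ≤ ∫ ω, realConjugate Φ |S ω| ∂P := by
      simp only [sub_zero]
      have hS0 := hS 0 1 zero_le_one
      simp only [one_mul, zero_add] at hS0
      refine integral_mono_ae (hσint' 0) hS0 ?_
      filter_upwards [hYS] with ω hω
      rw [zero_add]
      exact hΦ.monotone_realConjugate (hω _)
    exact (h0.trans h1).trans ((hRC x hx).trans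
      (hΦ.sub_le_integral (fun ω => hY0 _ ω) ((hσint' x).sub (integrable_const x))))

theorem iSup_stopping_le_randomized (f : ℝ → ℝ → ℝ) :
    ⨆ σ ∈ stoppingTimes F, ⨅ x : ℝ, ((∫ ω, f x (Y (σ ω) ω) ∂P : ℝ) : EReal) ≤
      ⨆ τ ∈ randomizedStoppingTimes F, ⨅ x : ℝ, ((∫ p : Ω × unitInterval,
        f x (Y (τ p.1 p.2) p.1) ∂(P.prod volume) : ℝ) : EReal) := by
  refine iSup₂_le fun σ hσ => ?_
  refine le_iSup₂_of_le (fun ω _ => σ ω) ⟨fun ω => monotone_const,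
    fun ω u => continuousWithinAt_const, fun u => hσ⟩ (le_of_eq ?_)
  refine iInf_congr fun x => ?_
  rw [integral_fun_fst (f := fun ω => f x (Y (σ ω) ω)), probReal_univ, one_smul]

end Value

end RobustStopping

/-! ### The main theorem -/

theorem proposition6p3 {Ω : Type*} {m0 : MeasurableSpace Ω} (P : Measure Ω)
    [IsProbabilityMeasure P] (T : ℝ) (hT : 0 < T)
    -- the filtration on `[0,T]`: right-continuous, with a trivial initial σ-algebra that
    -- contains all null sets
    (F : Filtration (Set.Icc (0 : ℝ) T) m0) (hFrc : F.IsRightContinuous)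
    (hF0 : ∀ A, MeasurableSet[F ⟨0, le_rfl, hT.le⟩] A → P A = 0 ∨ P A = 1)
    (hFnull : ∀ A, MeasurableSet A → P A = 0 → MeasurableSet[F ⟨0, le_rfl, hT.le⟩] A)
    (hatomless : ∀ t : Set.Icc (0 : ℝ) T, 0 < (t : ℝ) → RobustStopping.AtomlessOn P (F t))
    (hgen : ∀ t : Set.Icc (0 : ℝ) T, 0 < (t : ℝ) →
      RobustStopping.CountablyGeneratedModNull P (F t))
    (Φ : ℝ≥0 → ℝ≥0∞) (hΦ : RobustStopping.IsDivergenceFunction Φ)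
    -- the nonnegative, adapted, right-continuous process
    (Y : Set.Icc (0 : ℝ) T → Ω → ℝ) (hYnonneg : ∀ t ω, 0 ≤ Y t ω) (hYadapted : Adapted F Y)
    (hYrc : ∀ ω t, ContinuousWithinAt (fun s => Y s ω) (Set.Ioi t) t)
    -- `sup_t Y_t` is a.s. finite and belongs to the Orlicz heart of `Φ*`
    (hYbdd : ∀ᵐ ω ∂P, BddAbove (Set.range fun t => Y t ω))
    (hYsup : RobustStopping.MemOrliczHeart (RobustStopping.conjugate Φ) (fun ω => ⨆ t, Y t ω) P) :
    -- all the expectations below are well defined and finite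
    (∀ τ ∈ RobustStopping.randomizedStoppingTimes F, ∀ x : ℝ,
      Integrable (fun p : Ω × unitInterval =>
        RobustStopping.realConjugate Φ (x + Y (τ p.1 p.2) p.1) - x) (P.prod volume)) ∧
    (∀ τ ∈ RobustStopping.stoppingTimes F, ∀ x : ℝ,
      Integrable (fun ω => RobustStopping.realConjugate Φ (x + Y (τ ω) ω) - x) P) ∧
    (∀ τ ∈ RobustStopping.stoppingTimes F,
      ∀ Q ∈ RobustStopping.divergenceMeasures Φ P F ⟨0, le_rfl, hT.le⟩,
        Integrable (fun ω => Y (τ ω) ω) Q) ∧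
    -- randomization does not change the optimal value
    (⨆ τ ∈ RobustStopping.randomizedStoppingTimes F, ⨅ x : ℝ,
        ((∫ p : Ω × unitInterval,
          (RobustStopping.realConjugate Φ (x + Y (τ p.1 p.2) p.1) - x) ∂(P.prod volume) : ℝ) :
            EReal)) =
      (⨆ τ ∈ RobustStopping.stoppingTimes F, ⨅ x : ℝ,
        ((∫ ω, (RobustStopping.realConjugate Φ (x + Y (τ ω) ω) - x) ∂P : ℝ) : EReal)) ∧
    -- robust representation of the optimal value
    (⨆ τ ∈ RobustStopping.stoppingTimes F, ⨅ x : ℝ,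
        ((∫ ω, (RobustStopping.realConjugate Φ (x + Y (τ ω) ω) - x) ∂P : ℝ) : EReal)) =
      (⨆ τ ∈ RobustStopping.stoppingTimes F,
        ⨆ Q ∈ RobustStopping.divergenceMeasures Φ P F ⟨0, le_rfl, hT.le⟩,
          ((∫ ω, Y (τ ω) ω ∂Q : ℝ) : EReal) -
            ((∫⁻ ω, Φ (Q.rnDeriv P ω).toNNReal ∂P : ℝ≥0∞) : EReal)) := by
  have hYm : ∀ t, Measurable (Y t) := fun t => hYadapted.measurable
  have hYS : ∀ᵐ ω ∂P, ∀ t, Y t ω ≤ |⨆ t, Y t ω| := by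
    filter_upwards [hYbdd] with ω hω t
    exact (le_ciSup hω t).trans (le_abs_self _)
  have hS : ∀ x c : ℝ, 0 ≤ c →
      Integrable (fun ω => RobustStopping.realConjugate Φ (x + c * |⨆ t, Y t ω|)) P :=
    fun x c hc => hYsup.integrable_realConjugate hΦ x hc
  have hint2 : ∀ τ ∈ RobustStopping.stoppingTimes F, ∀ x : ℝ,
      Integrable (fun ω => RobustStopping.realConjugate Φ (x + 2 * Y (τ ω) ω)) P :=
    fun τ hτ x => hΦ.integrable_stopped hT.le hYnonneg hYm hYrc hYS hS hτ x zero_le_two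
  have hint : ∀ τ ∈ RobustStopping.stoppingTimes F, ∀ x : ℝ,
      Integrable (fun ω => RobustStopping.realConjugate Φ (x + Y (τ ω) ω)) P := fun τ hτ x => by
    simpa only [one_mul] using
      hΦ.integrable_stopped hT.le hYnonneg hYm hYrc hYS hS hτ x zero_le_one
  have hmeas : ∀ τ ∈ RobustStopping.stoppingTimes F, Measurable fun ω => Y (τ ω) ω :=
    fun τ hτ => RobustStopping.measurable_stopped hT.le hYm hYrc hτ
  refine ⟨fun τ hτ x => (hΦ.integrable_randomized_stopped hT.le hYnonneg hYm hYrc hYS hS hτ x).sub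
    (integrable_const x), fun τ hτ x => (hint τ hτ x).sub (integrable_const x), ?_, ?_, ?_⟩
  · rintro τ hτ Q ⟨hQ1, hQP, hQΦ, -⟩
    exact (hΦ.integrable_and_integral_sub_le (hmeas τ hτ) (fun ω => hYnonneg _ ω) (hint τ hτ)
      hQP hQΦ).1
  · exact le_antisymm (iSup₂_le fun τ hτ => hΦ.iInf_randomized_le hT hYnonneg hYm hYrc hYS hS
      hatomless hgen hτ) (RobustStopping.iSup_stopping_le_randomized
        fun x y => RobustStopping.realConjugate Φ (x + y) - x)
  · refine le_antisymm (iSup₂_mono fun τ hτ => ?_) (iSup₂_mono fun τ hτ => ?_)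
    · obtain ⟨x₀, Q, hQ1, hQP, hQΦ, hval⟩ := hΦ.exists_measure_integral_sub_eq (hmeas τ hτ)
        (fun ω => hYnonneg _ ω) (hint τ hτ) (hint2 τ hτ)
      refine (iInf_le _ x₀).trans (le_iSup₂_of_le Q ⟨hQ1, hQP, hQΦ, fun A hA => ?_⟩ ?_)
      -- Agreement on the initial σ-algebra is automatic: its events are null or co-null for `P`,
      -- hence likewise for `Q ≪ P`.
      · rcases hF0 A hA with h | h
        · rw [h, hQP h]
        · rw [h, ← prob_compl_eq_zero_iff (F.le _ _ hA)]
          exact hQP ((prob_compl_eq_zero_iff (F.le _ _ hA)).2 h)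
      · rw [← hval, EReal.coe_sub, EReal.coe_ennreal_toReal hQΦ.ne]
    · refine iSup₂_le fun Q ⟨hQ1, hQP, hQΦ, _⟩ => le_iInf fun x => ?_
      rw [← EReal.coe_ennreal_toReal hQΦ.ne, ← EReal.coe_sub, EReal.coe_le_coe_iff]
      exact (hΦ.integrable_and_integral_sub_le (hmeas τ hτ) (fun ω => hYnonneg _ ω) (hint τ hτ)
        hQP hQΦ).2 x
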